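/- Setting. Let $\mathcal I\subset\mathbb R^n$ be an $m$-dimensional smooth embedded submanifold with the Riemannian metric inherited from the Euclidean inner product, let $\mathcal O$ be a smooth Riemannian manifold, and let $\mathcal S\subset\mathcal I\times\mathcal O$ be a smoothly embedded $m$-dimensional submanifold with coordinate projections $\pi_{\mathcal I}:\mathcal S\to\mathcal I$ and $\pi_{\mathcal O}:\mathcal S\to\mathcal O$. For a smooth map $f$ between Riemannian manifolds defined near $x$, Rice's condition number is $\kappa[f](x)=\lim_{\epsilon\to0}\sup_{\mathrm{dist}(x,x')\le\epsilon}\mathrm{dist}(f(x),f(x'))/\mathrm{dist}(x,x')$. The condition number $\kappa[\mathcal M](z)$ of a manifold $\mathcal M$ with an input projection $p:\mathcal M\to\mathcal X$ and an output projection $q:\mathcal M\to\mathcal Y$ to Riemannian manifolds is $\kappa[q\circ p^{-1}](p(z))$, with $p^{-1}$ the smooth local inverse of $p$ at $z$, if the derivative $\mathrm D p(z)$ is invertible, and $\infty$ otherwise. In particular this defines $\kappa[\mathcal S](x,y)$, with $p=\pi_{\mathcal I}$ and $q=\pi_{\mathcal O}$. Put $\mathcal W=\{(x,y)\in\mathcal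 S:\kappa[\mathcal S](x,y)<\infty\}$. Assume that $\pi_{\mathcal I}$ is surjective and that $\mathcal W$ is an open dense submanifold of $\mathcal S$. Let $\mathcal S_{\mathrm{CPP}}=\{(a,x)\in\mathbb R^n\times\mathcal I: a-x\in \mathrm N_x\mathcal I\}$, where $\mathrm N_x\mathcal I$ is the normal space, and let $\mathcal W_{\mathrm{CPP}}$ be the set of the $(a,x)\in\mathcal S_{\mathrm{CPP}}$ at which the derivative of the projection $\mathcal S_{\mathrm{CPP}}\to\mathbb R^n$, $(a,x)\mapsto a$, is invertible. Let $$\mathcal S_{\mathrm{GCPP}}=\{(a,x,y): (a,x)\in\mathcal S_{\mathrm{CPP}},\ (x,y)\in\mathcal S\},\qquad \mathcal W_{\mathrm{GCPP}}=\{(a,x,y): (a,x)\in\mathcal W_{\mathrm{CPP}},\ (x,y)\in\mathcal W\}.$$ The condition number $\kappa[\mathcal S_{\mathrm{GCPP}}](a,x,y)$ is that of the manifold $\mathcal W_{\mathrm{GCPP}}$ with input projection $(a,x,y)\mapsto a$ and output projection $(a,x,y)\mapsto y$ if $(a,x,y)\in\mathcal W_{\mathrm{GCPP}}$, and $\infty$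 if $(a,x,y)\in\mathcal S_{\mathrm{GCPP}}\setminus\mathcal W_{\mathrm{GCPP}}$. For a normal vector $\eta\in\mathrm N_x\mathcal I$ let $S_\eta:\mathrm T_x\mathcal I\to\mathrm T_x\mathcal I$, $S_\eta(v)=\mathrm P_{\mathrm T_x\mathcal I}(-\mathrm D_vN)$, be the Weingarten map, where $N$ is a smooth normal vector field with $N(x)=\eta$ and $\mathrm P_{\mathrm T_x\mathcal I}$ is the orthogonal projection onto the tangent space; let $H_\eta=\mathbf 1-S_\eta$. For a linear map $L$ from $\mathrm T_x\mathcal I$ to $\mathrm T_y\mathcal O$ let $\|L\|_{\mathcal I\to\mathcal O}=\sup_{v\ne0}\|Lv\|_{\mathcal O}/\|v\|_{\mathcal I}$; an expression of this form that contains the inverse of a non-invertible map is $\infty$ by convention. Theorem (Generalized critical points). Let $(a,x,y)\in\mathcal S_{\mathrm{GCPP}}$ and $\eta=a-x$. Then $H_\eta$ is the Riemannian Hessian at $x$ of the function $x'\mapsto\frac12\|x'-a\|^2$ on $\mathcal I$, and $$\kappa[\mathcal S_{\mathrm{GCPP}}](a,x,y)=\big\|(\mathrm D\pi_{\mathcal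 O}(x,y))\,(\mathrm D\pi_{\mathcal I}(x,y))^{-1}\,H_\eta^{-1}\big\|_{\mathcal I\to\mathcal O}.$$ Moreover, if $(a,x,y)\in\mathcal S_{\mathrm{GCPP}}\setminus\mathcal W_{\mathrm{GCPP}}$, then $\mathrm D\pi_{\mathcal I}(x,y)$ or $H_\eta$ is not invertible. -/

import Mathlib

open Manifold Bundle Set Topology
open scoped ContDiff ENNReal

noncomputable section

section Generic

variable {EX HX EY HY EM HM : Type*}
  [NormedAddCommGroup EX] [NormedSpace ℝ EX] [TopologicalSpace HX]
  [NormedAddCommGroup EY] [NormedSpace ℝ EY] [TopologicalSpace HY]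
  [NormedAddCommGroup EM] [NormedSpace ℝ EM] [TopologicalSpace HM]
  (IX : ModelWithCorners ℝ EX HX) (IY : ModelWithCorners ℝ EY HY) (IM : ModelWithCorners ℝ EM HM)
  {X Y M : Type*}
  [TopologicalSpace X] [ChartedSpace HX X]
  [TopologicalSpace Y] [ChartedSpace HY Y]
  [TopologicalSpace M] [ChartedSpace HM M]

/-- Rice's condition number of `f : X → Y` at `x`:
`lim_{ε → 0} sup { dist (f x) (f x') / dist x x' : dist x x' ≤ ε }`, for the Riemannian distances
of `X` and `Y`. The supremum decreases with `ε`, so the limit is an infimum. The term `x' = x`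
contributes `0 / 0 = 0`. -/
def riceCondition [RiemannianBundle (fun x : X => TangentSpace IX x)]
    [RiemannianBundle (fun y : Y => TangentSpace IY y)] (f : X → Y) (x : X) : ℝ≥0∞ :=
  ⨅ (ε : ℝ≥0∞) (_ : 0 < ε), ⨆ (x' : X) (_ : riemannianEDist IX x x' ≤ ε),
    riemannianEDist IY (f x) (f x') / riemannianEDist IX x x'

/-- The tangent space at `z` of a subset `A` of a manifold `M`: the span of the velocities at time
`0` of the smooth curves in `M` that run inside `A` and are at `z` at time `0`. For an embedded
submanifold `A` this is its tangent space, as a subspace of the one of `M`. -/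
def curveTangentSpace (A : Set M) (z : M) : Submodule ℝ (TangentSpace IM z) :=
  Submodule.span ℝ {v | ∃ γ : ℝ → M, ContMDiff 𝓘(ℝ, ℝ) IM ∞ γ ∧ γ 0 = z ∧ (∀ t, γ t ∈ A) ∧
    (mfderiv 𝓘(ℝ, ℝ) IM γ 0 (1 : ℝ) : EM) = v}

/-- The derivative at `z` of the restriction of `p : M → X` to `A ⊆ M` is an invertible linear map
from the tangent space of `A` to the one of `X`. -/
def DerivInvertibleOn (A : Set M) (p : M → X) (z : M) : Prop :=
  Function.Bijective
    ((mfderiv IM IX p z).toLinearMap.domRestrict (curveTangentSpace IM A z))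

/-- `φ` is, near `p z`, a smooth inverse of the restriction of `p` to a neighbourhood of `z` in
`A`. -/
structure IsLocalInverseOn (A : Set M) (p : M → X) (z : M) (φ : X → M) : Prop where
  smooth : ContMDiffAt IX IM ∞ φ (p z)
  base : φ (p z) = z
  right_inv : ∀ᶠ x in 𝓝 (p z), φ x ∈ A ∧ p (φ x) = x
  left_inv : ∀ᶠ w in 𝓝[A] z, φ (p w) = w

open Classical in
/-- The condition number at `z ∈ A` of the computational problem modelled by the set `A`, with
input map `p : A → X` and output map `q : A → Y`: if the derivative of `p` restricted to `A` is
invertible at `z`, it is Rice's condition number at `p z` of the local solution map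
`q ∘ (p|_A)⁻¹`, and otherwise it is `∞`.
All local inverses have the same germ at `p z`, so the infimum is over equal numbers. -/
def conditionNumber [RiemannianBundle (fun x : X => TangentSpace IX x)]
    [RiemannianBundle (fun y : Y => TangentSpace IY y)]
    (A : Set M) (p : M → X) (q : M → Y) (z : M) : ℝ≥0∞ :=
  if DerivInvertibleOn IX IM A p z then
    ⨅ (φ : X → M) (_ : IsLocalInverseOn IX IM A p z φ), riceCondition IX IY (q ∘ φ) (p z)
  else ⊤

/-- The spectral norm `sup { ‖L v‖ / ‖v‖ : v ≠ 0 }` of a linear map between tangent spaces of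
Riemannian manifolds. -/
def operatorSpectralNorm [RiemannianBundle (fun x : X => TangentSpace IX x)]
    [RiemannianBundle (fun y : Y => TangentSpace IY y)] {x : X} {y : Y}
    (L : TangentSpace IX x →L[ℝ] TangentSpace IY y) : ℝ≥0∞ :=
  ⨆ (v : TangentSpace IX x) (_ : v ≠ 0), ‖L v‖ₑ / ‖v‖ₑ

end Generic

section Submanifold

variable {n m : ℕ} {I : Set (EuclideanSpace ℝ (Fin n))} [ChartedSpace (EuclideanSpace ℝ (Fin m)) I]

/-- The derivative at `x` of the inclusion `I → ℝⁿ`; it identifies the intrinsic tangent space of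
`I` at `x` with a linear subspace of `ℝⁿ`. -/
def tangentIncl (x : I) : TangentSpace (𝓡 m) x →L[ℝ] EuclideanSpace ℝ (Fin n) :=
  mfderiv (𝓡 m) (𝓡 n) (Subtype.val : I → EuclideanSpace ℝ (Fin n)) x

/-- The tangent space of `I` at `x` as a linear subspace of `ℝⁿ`. -/
def tangentSub (x : I) : Submodule ℝ (EuclideanSpace ℝ (Fin n)) :=
  LinearMap.range (tangentIncl (m := m) x).toLinearMap

/-- The normal space of `I` at `x`. -/
def normalSub (x : I) : Submodule ℝ (EuclideanSpace ℝ (Fin n)) :=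
  (tangentSub (m := m) x)ᗮ

/-- The orthogonal projection of `ℝⁿ` onto the tangent space of `I` at `x`, read in the intrinsic
tangent space through the identification `tangentIncl`. -/
def tangentProj (x : I) : EuclideanSpace ℝ (Fin n) →L[ℝ] TangentSpace (𝓡 m) x :=
  ((tangentIncl (m := m) x).codRestrict (tangentSub (m := m) x)
    (fun v => LinearMap.mem_range_self (tangentIncl (m := m) x).toLinearMap v)).inverse ∘L
    (tangentSub (m := m) x).orthogonalProjectionOnto

/-- The Weingarten map (shape operator) `S_η` of `I` at `x` in the direction of a normal vector
`η`: `S_η v = P_T (- D_v N)`, where `N` is a normal vector field along `I` with `N x = η`, and `P_T`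
is the orthogonal projection onto the tangent space at `x`. The field taken here is
`N x' =` (orthogonal projection of `η` onto the normal space at `x'`). -/
def weingarten (x : I) (η : EuclideanSpace ℝ (Fin n)) :
    TangentSpace (𝓡 m) x →L[ℝ] TangentSpace (𝓡 m) x :=
  tangentProj (m := m) x ∘L
    (-(mfderiv (𝓡 m) (𝓡 n) (fun x' : I => (normalSub (m := m) x').starProjection η) x :
      TangentSpace (𝓡 m) x →L[ℝ] EuclideanSpace ℝ (Fin n)))

/-- `H_η = 1 - S_η`. -/
def curvatureOperator (x : I) (η : EuclideanSpace ℝ (Fin n)) :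
    TangentSpace (𝓡 m) x →L[ℝ] TangentSpace (𝓡 m) x :=
  ContinuousLinearMap.id ℝ (TangentSpace (𝓡 m) x) - weingarten x η

/-- The Riemannian gradient of `f : I → ℝ` at `x`: the tangent vector dual to the derivative. -/
def riemannianGradient [RiemannianBundle (fun x : I => TangentSpace (𝓡 m) x)]
    (f : I → ℝ) (x : I) : TangentSpace (𝓡 m) x :=
  haveI : FiniteDimensional ℝ (TangentSpace (𝓡 m) x) :=
    inferInstanceAs (FiniteDimensional ℝ (EuclideanSpace ℝ (Fin m)))
  haveI : CompleteSpace (TangentSpace (𝓡 m) x) := FiniteDimensional.complete ℝ _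
  (InnerProductSpace.toDual ℝ (TangentSpace (𝓡 m) x)).symm
    (mfderiv (𝓡 m) 𝓘(ℝ, ℝ) f x : TangentSpace (𝓡 m) x →L[ℝ] ℝ)

/-- The Riemannian Hessian of `f : I → ℝ` at `x`: the tangential part of the derivative of the
gradient, viewed as an `ℝⁿ`-valued map on `I`. -/
def riemannianHessian [RiemannianBundle (fun x : I => TangentSpace (𝓡 m) x)]
    (f : I → ℝ) (x : I) : TangentSpace (𝓡 m) x →L[ℝ] TangentSpace (𝓡 m) x :=
  tangentProj (m := m) x ∘L
    (mfderiv (𝓡 m) (𝓡 n) (fun x' : I => tangentIncl (m := m) x' (riemannianGradient f x')) x :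
      TangentSpace (𝓡 m) x →L[ℝ] EuclideanSpace ℝ (Fin n))

variable (m) in
/-- The critical point locus `{(a, x) : a - x ∈ N_x I}`. -/
def criticalLocus (I : Set (EuclideanSpace ℝ (Fin n))) [ChartedSpace (EuclideanSpace ℝ (Fin m)) I] :
    Set (EuclideanSpace ℝ (Fin n) × I) :=
  {z | z.1 - (z.2 : EuclideanSpace ℝ (Fin n)) ∈ normalSub (m := m) z.2}

variable (m) in
/-- The well-posed pairs of the critical point problem: the derivative of the projection of the
critical point locus to `ℝⁿ` is invertible. -/
def criticalWellPosed (I : Set (EuclideanSpace ℝ (Fin n)))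
    [ChartedSpace (EuclideanSpace ℝ (Fin m)) I] : Set (EuclideanSpace ℝ (Fin n) × I) :=
  {z ∈ criticalLocus m I |
    DerivInvertibleOn (𝓡 n) ((𝓡 n).prod (𝓡 m)) (criticalLocus m I) Prod.fst z}

end Submanifold

section Problem

variable {n m k : ℕ} {I : Set (EuclideanSpace ℝ (Fin n))} [ChartedSpace (EuclideanSpace ℝ (Fin m)) I]
  [RiemannianBundle (fun x : I => TangentSpace (𝓡 m) x)]
  {O : Type*} [TopologicalSpace O] [ChartedSpace (EuclideanSpace ℝ (Fin k)) O]
  [RiemannianBundle (fun y : O => TangentSpace (𝓡 k) y)]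

variable (m k) in
/-- The well-posed pairs of the problem `S ⊆ I × O`: its condition number is finite. -/
def wellPosed (S : Set (I × O)) : Set (I × O) :=
  {s ∈ S | conditionNumber (𝓡 m) (𝓡 k) ((𝓡 m).prod (𝓡 k)) S Prod.fst Prod.snd s < ⊤}

variable (m) in
/-- The locus `S_GCPP` of the triples `(a, x, y)` with `a - x` normal to `I` at `x` and
`(x, y) ∈ S`. -/
def gcppLocus (S : Set (I × O)) : Set (EuclideanSpace ℝ (Fin n) × (I × O)) :=
  {z | (z.1, z.2.1) ∈ criticalLocus m I ∧ z.2 ∈ S}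

variable (m k) in
/-- The well-posed triples `W_GCPP`. -/
def gcppWellPosed (S : Set (I × O)) : Set (EuclideanSpace ℝ (Fin n) × (I × O)) :=
  {z | (z.1, z.2.1) ∈ criticalWellPosed m I ∧ z.2 ∈ wellPosed m k S}

open Classical in
variable (m k) in
/-- The condition number of the generalized critical point problem, with input `a` and output `y`:
the one of the solution manifold `W_GCPP` at well-posed triples, and `∞` at ill-posed ones. -/
def gcppConditionNumber (S : Set (I × O)) (z : EuclideanSpace ℝ (Fin n) × (I × O)) : ℝ≥0∞ :=
  if z ∈ gcppWellPosed m k S then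
    conditionNumber (𝓡 n) (𝓡 k) ((𝓡 n).prod ((𝓡 m).prod (𝓡 k))) (gcppWellPosed m k S)
      Prod.fst (fun w => w.2.2) z
  else ⊤

variable (m k) in
/-- The derivative at `s ∈ S` of the projection `π_I : S → I`. -/
def derivInput (S : Set (I × O)) [ChartedSpace (EuclideanSpace ℝ (Fin m)) S] (s : S) :
    TangentSpace (𝓡 m) s →L[ℝ] TangentSpace (𝓡 m) s.1.1 :=
  mfderiv (𝓡 m) (𝓡 m) (fun s : S => s.1.1) s

variable (m k) in
/-- The derivative at `s ∈ S` of the projection `π_O : S → O`. -/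
def derivOutput (S : Set (I × O)) [ChartedSpace (EuclideanSpace ℝ (Fin m)) S] (s : S) :
    TangentSpace (𝓡 m) s →L[ℝ] TangentSpace (𝓡 k) s.1.2 :=
  mfderiv (𝓡 m) (𝓡 k) (fun s : S => s.1.2) s

open Classical in
variable (m k) in
/-- The spectral norm `‖(Dπ_O) (Dπ_I)⁻¹ H_η⁻¹‖` at `s ∈ S`, which is `∞` by convention when
`Dπ_I` or `H_η` is not invertible. -/
def gcppSpectralNorm (S : Set (I × O)) [ChartedSpace (EuclideanSpace ℝ (Fin m)) S] (s : S)
    (η : EuclideanSpace ℝ (Fin n)) : ℝ≥0∞ :=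
  if (derivInput m S s).IsInvertible ∧
      (curvatureOperator (m := m) s.1.1 η).IsInvertible then
    operatorSpectralNorm (𝓡 m) (𝓡 k) (derivOutput m k S s ∘L (derivInput m S s).inverse ∘L
      (curvatureOperator (m := m) s.1.1 η).inverse)
  else ⊤

end Problem

end

open Filter
open scoped NNReal

noncomputable section

/-! Two facts carry the theorem.

The first is that Rice's condition number of a C¹ map is the operator norm of its derivative
(`riceCondition_eq`). For the upper bound, the derivative bound is integrated along nearly shortest
curves. For the lower bound, the map is sandwiched between a curve in the source and a function on
the target, which reduces the claim to a real function on the line. Hence a problem with a smooth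
local inverse `φ` has condition number `‖D(q ∘ φ)‖`, and in particular a finite one
(`IsSmoothLocalInverseOn.conditionNumber_eq`).

The second is the derivative of the critical point equation. Let `P_x` be the orthogonal projection
onto the tangent space at `x`; it depends smoothly on `x`, and the critical locus is `P_x (a - x) =
0`. The Weingarten map is the tangential part of `w ↦ (D_w P) η`. Differentiating `P_x (a - x)`
therefore gives `P_x ȧ - H_η ẋ` as tangential part, and with `a` held fixed it gives the Hessian
formula as well. If `H_η` is invertible, the inverse function theorem solves for `x` with derivative
`H_η⁻¹ P_x` (`exists_isSmoothLocalInverseOn_criticalLocus`). If `H_η w = 0` with `w ≠ 0`, then `(0,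
w)` is tangent to the critical locus and the projection to `a` is singular
(`isInvertible_curvatureOperator_of_derivInvertibleOn`).

Consequently a triple is well-posed exactly when `Dπ_I` and `H_η` are both invertible
(`mem_gcppWellPosed_iff`). There the solution map is a composite with derivative `Dπ_O (Dπ_I)⁻¹
H_η⁻¹ P_x`. The factor `P_x` does not change the norm, because it is a contraction that the
isometric inclusion of the tangent space splits. Elsewhere both sides are `∞`. -/

/-! ### Rice's condition number as the norm of the derivative. -/

lemma isContinuousRiemannianBundle_of_contMDiff {E H F B : Type*} [NormedAddCommGroup E] [NormedSpace ℝ E] [TopologicalSpace H]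
   (IB : ModelWithCorners ℝ E H) (n : ℕ∞ω) [TopologicalSpace B] [ChartedSpace H B]
   [NormedAddCommGroup F] [NormedSpace ℝ F] (V : B → Type*) [TopologicalSpace (TotalSpace F V)]
   [∀ x, NormedAddCommGroup (V x)] [∀ x, InnerProductSpace ℝ (V x)]
   [FiberBundle F V] [VectorBundle ℝ F V]
   [h : IsContMDiffRiemannianBundle IB n F V] : IsContinuousRiemannianBundle F V := by
  obtain ⟨g, hg, hg'⟩ := h.exists_contMDiff
  exact ⟨g, hg.continuous, hg'⟩

instance {F : Type*} [NormedAddCommGroup F] [InnerProductSpace ℝ F] : IsContinuousRiemannianBundle F (fun x : F => TangentSpace 𝓘(ℝ, F) x) :=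
  isContinuousRiemannianBundle_of_contMDiff 𝓘(ℝ, F) ∞ _

lemma eventually_norm_comp_comp_lt {X E F V W : Type*} [TopologicalSpace X]
    [NormedAddCommGroup E] [NormedSpace ℝ E] [NormedAddCommGroup F] [NormedSpace ℝ F]
    [NormedAddCommGroup V] [NormedSpace ℝ V] [NormedAddCommGroup W] [NormedSpace ℝ W]
    {A : X → E →L[ℝ] F} {x : X} (hA : ContinuousAt A x) (a : V →L[ℝ] E) (b : F →L[ℝ] W) {c : ℝ}
    (hc : ‖b ∘L A x ∘L a‖ < c) : ∀ᶠ x' in 𝓝 x, ‖b ∘L A x' ∘L a‖ < c :=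
  (continuousAt_const.clm_comp (hA.clm_comp continuousAt_const)).norm.eventually_lt_const hc

section
variable {EX HX EY HY EM HM : Type*}
  [NormedAddCommGroup EX] [NormedSpace ℝ EX] [TopologicalSpace HX]
  [NormedAddCommGroup EY] [NormedSpace ℝ EY] [TopologicalSpace HY]
  {IX : ModelWithCorners ℝ EX HX} {IY : ModelWithCorners ℝ EY HY}
  {X Y M : Type*}
  [TopologicalSpace X] [ChartedSpace HX X]
  [TopologicalSpace Y] [ChartedSpace HY Y]
  [RiemannianBundle (fun x : X => TangentSpace IX x)]
  [RiemannianBundle (fun y : Y => TangentSpace IY y)]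

lemma operatorSpectralNorm_eq_enorm {x : X} {y : Y} (L : TangentSpace IX x →L[ℝ] TangentSpace IY y) :
   operatorSpectralNorm IX IY L = ‖L‖ₑ := by
  unfold operatorSpectralNorm
  apply le_antisymm
  · refine iSup₂_le fun v hv => ENNReal.div_le_of_le_mul (L.le_opENorm v)
  · refine ContinuousLinearMap.opENorm_le_bound _ fun v => ?_
    rcases eq_or_ne v 0 with rfl | hv
    · simp
    rw [← ENNReal.div_le_iff (by simpa using hv) (by simp)]
    exact le_iSup₂ (f := fun (v : TangentSpace IX x) (_ : v ≠ 0) => ‖L v‖ₑ / ‖v‖ₑ) v hv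

variable [IsManifold IX 1 X] [IsManifold IY 1 Y]
  [IsContinuousRiemannianBundle EX (fun x : X => TangentSpace IX x)]
  [IsContinuousRiemannianBundle EY (fun x : Y => TangentSpace IY x)]

/-- The norms live on varying fibres, so continuity of the derivative does not give this at once.
Trivializations move the derivative to the fibres over `x` and `f x`, and continuity of the metrics
makes the cost of the move a factor close to `1`. -/
lemma eventually_norm_mfderiv_lt {f : X → Y} {x : X} (hf : ContMDiffAt IX IY 1 f x) {C : ℝ}
    (hC : ‖mfderiv IX IY f x‖ < C) : ∀ᶠ x' in 𝓝 x, ‖mfderiv IX IY f x'‖ < C := by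
  let tX := trivializationAt EX (TangentSpace IX : X → Type _) x
  let tY := trivializationAt EY (TangentSpace IY : Y → Type _) (f x)
  let A : X → EX →L[ℝ] EY := inTangentCoordinates IX IY id f (mfderiv IX IY f) x
  have hA : ContinuousAt A x := (hf.mfderiv_const (m := 0) (by simp)).continuousAt
  -- The derivative at `x'` read between the two fixed fibres, where its norm is continuous in `x'`.
  let Q : X → TangentSpace IX x →L[ℝ] TangentSpace IY (f x) := fun x' =>
    (tY.symmL ℝ (f x)) ∘L (A x') ∘L (tX.continuousLinearMapAt ℝ x)
  have hxb : x ∈ tX.baseSet := FiberBundle.mem_baseSet_trivializationAt' x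
  have hyb : f x ∈ tY.baseSet := FiberBundle.mem_baseSet_trivializationAt' (f x)
  have hAx : ∀ x', x' ∈ tX.baseSet → f x' ∈ tY.baseSet → ∀ v : TangentSpace IX x',
       tY.symmL ℝ (f x') (A x' (tX.continuousLinearMapAt ℝ x' v)) = mfderiv IX IY f x' v := by
    intro x' h1 h2 v
    have e : A x' (tX.continuousLinearMapAt ℝ x' v) = tY.continuousLinearMapAt ℝ (f x')
        (mfderiv IX IY f x' (tX.symmL ℝ x' (tX.continuousLinearMapAt ℝ x' v))) := rfl
    rw [e, tX.symmL_continuousLinearMapAt h1, tY.symmL_continuousLinearMapAt h2]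
  have hQx : Q x = mfderiv IX IY f x := by
    ext v
    exact hAx x hxb hyb v
  obtain ⟨c, hc1, hc2⟩ := exists_between hC
  have hc0 : 0 ≤ c := (ContinuousLinearMap.opNorm_nonneg _).trans hc1.le
  -- One factor `r` pays for the change of fibre in the source, the other for the one in the target.
  obtain ⟨r, hr1, hr2⟩ : ∃ r : ℝ, 1 < r ∧ r * (c * r) < C := by
    have : Tendsto (fun r : ℝ => r * (c * r)) (𝓝[>] 1) (𝓝 (1 * (c * 1))) :=
      (Continuous.tendsto (by fun_prop) _).mono_left nhdsWithin_le_nhds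
    have h2 := this.eventually_lt_const (show 1 * (c * 1) < C by simpa)
    obtain ⟨r, h1, h3⟩ := (h2.and self_mem_nhdsWithin).exists
    exact ⟨r, h3, h1⟩
  have hQc : ∀ᶠ x' in 𝓝 x, ‖Q x'‖ < c :=
    eventually_norm_comp_comp_lt hA (tX.continuousLinearMapAt ℝ x) (tY.symmL ℝ (f x))
      (lt_of_eq_of_lt (congrArg _ hQx) hc1)
  filter_upwards [hQc, tX.open_baseSet.mem_nhds hxb, hf.continuousAt (tY.open_baseSet.mem_nhds hyb),
    eventually_norm_symmL_trivializationAt_self_comp_lt EX (fun x : X => TangentSpace IX x) x hr1,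
    hf.continuousAt.eventually (eventually_norm_symmL_trivializationAt_comp_self_lt EY (fun x : Y => TangentSpace IY x) (f x) hr1)]
    with x' h1 h2 h3 h4 h5
  have key : mfderiv IX IY f x' = (tY.symmL ℝ (f x') ∘L tY.continuousLinearMapAt ℝ (f x)) ∘L
       (Q x' ∘L (tX.symmL ℝ x ∘L tX.continuousLinearMapAt ℝ x')) := by
    ext v
    rw [← hAx x' h2 h3 v]
    simp only [ContinuousLinearMap.comp_apply, Q]
    rw [tX.continuousLinearMapAt_symmL hxb, tY.continuousLinearMapAt_symmL hyb]
  rw [key]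
  refine lt_of_le_of_lt ?_ hr2
  have hr0 : 0 ≤ r := zero_le_one.trans hr1.le
  refine (ContinuousLinearMap.opNorm_comp_le _ _).trans
    (mul_le_mul h5.le ?_ (ContinuousLinearMap.opNorm_nonneg _) hr0)
  exact (ContinuousLinearMap.opNorm_comp_le _ _).trans
    (mul_le_mul h1.le h4.le (ContinuousLinearMap.opNorm_nonneg _) hc0)
end

section
variable {EX HX EY HY : Type*}
  [NormedAddCommGroup EX] [NormedSpace ℝ EX] [TopologicalSpace HX]
  [NormedAddCommGroup EY] [NormedSpace ℝ EY] [TopologicalSpace HY]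
  {IX : ModelWithCorners ℝ EX HX} {IY : ModelWithCorners ℝ EY HY}
  {X Y : Type*}
  [TopologicalSpace X] [ChartedSpace HX X]
  [TopologicalSpace Y] [ChartedSpace HY Y]
  [RiemannianBundle (fun x : X => TangentSpace IX x)]
  [RiemannianBundle (fun y : Y => TangentSpace IY y)]
  [IsManifold IX 1 X] [IsManifold IY 1 Y]
  [IsContinuousRiemannianBundle EX (fun x : X => TangentSpace IX x)]
  [IsContinuousRiemannianBundle EY (fun x : Y => TangentSpace IY x)]

/-- A curve from `x` shorter than `δ` stays in the `δ`-ball, where the derivative bound holds, so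
`f` lengthens it by at most the factor `C`. -/
lemma exists_riemannianEDist_map_le [RegularSpace X] {f : X → Y} {x : X}
    (hf : ContMDiffAt IX IY 1 f x) {C : ℝ≥0} (hC : ‖mfderiv IX IY f x‖ < C) :
    ∃ δ > 0, ∀ x', riemannianEDist IX x x' < δ →
      riemannianEDist IY (f x) (f x') ≤ C * riemannianEDist IX x x' := by
  have hC0 : (C : ℝ≥0∞) ≠ 0 := by
    have : (0 : ℝ) < C := (ContinuousLinearMap.opNorm_nonneg _).trans_lt hC
    simpa using (NNReal.coe_pos.1 this).ne'
  obtain ⟨δ, hδ, hsub⟩ := setOfPred_riemannianEDist_lt_subset_nhds' IX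
    ((eventually_norm_mfderiv_lt hf hC).and (contMDiffAt_iff_contMDiffAt_nhds (by simp) |>.1 hf))
  refine ⟨δ, hδ, fun x' hx' => ?_⟩
  rw [mul_comm, ← ENNReal.div_le_iff_le_mul (.inl hC0) (.inl ENNReal.coe_ne_top)]
  refine le_of_forall_gt fun r hr => ?_
  obtain ⟨γ, h0, h1, hγ, hlen, -, -⟩ :=
    exists_lt_locally_constant_of_riemannianEDist_lt (lt_min hr hx') zero_lt_one
  have hmem : ∀ t ∈ Icc (0 : ℝ) 1, ‖mfderiv IX IY f (γ t)‖ < C ∧ ContMDiffAt IX IY 1 f (γ t) := by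
    intro t ht
    refine hsub (?_ : riemannianEDist IX x (γ t) < δ)
    calc riemannianEDist IX x (γ t) ≤ pathELength IX γ 0 t :=
          riemannianEDist_le_pathELength hγ.contMDiffOn h0 rfl ht.1
      _ ≤ pathELength IX γ 0 1 := pathELength_mono le_rfl ht.2
      _ < δ := hlen.trans_le (min_le_right _ _)
  have hle : riemannianEDist IY (f x) (f x') ≤ C * pathELength IX γ 0 1 := by
    calc riemannianEDist IY (f x) (f x') ≤ pathELength IY (f ∘ γ) 0 1 := by
          refine riemannianEDist_le_pathELength (fun t ht => ?_) (by simp [h0]) (by simp [h1])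
            zero_le_one
          exact ((hmem t ht).2.comp t hγ.contMDiffAt).contMDiffWithinAt
      _ ≤ C * pathELength IX γ 0 1 := by
          rw [pathELength_eq_lintegral_mfderiv_Icc, pathELength_eq_lintegral_mfderiv_Icc,
            ← MeasureTheory.lintegral_const_mul' _ _ ENNReal.coe_ne_top]
          refine MeasureTheory.setLIntegral_mono' measurableSet_Icc fun t ht => ?_
          have hd : mfderiv 𝓘(ℝ, ℝ) IY (f ∘ γ) t =
              mfderiv IX IY f (γ t) ∘L mfderiv 𝓘(ℝ, ℝ) IX γ t :=
            mfderiv_comp t ((hmem t ht).2.mdifferentiableAt one_ne_zero)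
              (hγ.mdifferentiableAt one_ne_zero)
          rw [hd]
          refine ((mfderiv IX IY f (γ t)).le_opENorm _).trans ?_
          exact mul_le_mul' (enorm_le_coe.2 (hmem t ht).1.le) le_rfl
  refine lt_of_le_of_lt ?_ (hlen.trans_le (min_le_left _ _))
  exact ENNReal.div_le_of_le_mul' hle
end

section
variable {E H : Type*} [NormedAddCommGroup E] [NormedSpace ℝ E] [TopologicalSpace H]
  {J : ModelWithCorners ℝ E H} {X : Type*} [TopologicalSpace X] [ChartedSpace H X]

lemma mfderiv_extChartAt_symm_self [J.Boundaryless] [IsManifold J 1 X] (x : X) :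
    mfderiv 𝓘(ℝ, E) J (extChartAt J x).symm (extChartAt J x x) = ContinuousLinearMap.id ℝ E := by
  have := mfderivWithin_range_extChartAt_symm (I := J) (x := x)
  rwa [J.range_eq_univ, mfderivWithin_univ] at this

lemma contMDiffAt_extChartAt_symm_of_mem [J.Boundaryless] {n : ℕ∞ω} [IsManifold J n X] {x : X} {e : E}
    (he : e ∈ (extChartAt J x).target) : ContMDiffAt 𝓘(ℝ, E) J n (extChartAt J x).symm e :=
  (contMDiffOn_extChartAt_symm x).contMDiffAt ((isOpen_extChartAt_target x).mem_nhds he)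

lemma exists_curve_mfderiv_eq [J.Boundaryless] [IsManifold J 1 X] {x : X} (v : TangentSpace J x) :
    ∃ γ : ℝ → X, γ 0 = x ∧ ContMDiffAt 𝓘(ℝ, ℝ) J 1 γ 0 ∧
      (mfderiv 𝓘(ℝ, ℝ) J γ 0 (1 : ℝ) : E) = v := by
  let w : E := v
  let l : ℝ → E := fun t => extChartAt J x x + t • w
  have hl : HasFDerivAt l ((ContinuousLinearMap.id ℝ ℝ).smulRight w) 0 :=
    ((hasFDerivAt_id (0 : ℝ)).smul_const w).const_add _
  have hl0 : l 0 = extChartAt J x x := by simp [l]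
  have hs : ContMDiffAt 𝓘(ℝ, E) J 1 (extChartAt J x).symm (l 0) :=
    hl0 ▸ contMDiffAt_extChartAt_symm_of_mem (mem_extChartAt_target x)
  have hlc : ContMDiffAt 𝓘(ℝ, ℝ) 𝓘(ℝ, E) 1 l 0 := by
    rw [contMDiffAt_iff_contDiffAt]
    fun_prop
  refine ⟨(extChartAt J x).symm ∘ l, by simp [hl0], hs.comp 0 hlc, ?_⟩
  rw [mfderiv_comp 0 (hs.mdifferentiableAt one_ne_zero) (hlc.mdifferentiableAt one_ne_zero), hl0,
    mfderiv_extChartAt_symm_self, mfderiv_eq_fderiv, hl.fderiv]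
  exact one_smul ℝ w

lemma exists_mfderiv_eq_functional [IsManifold J 1 X] {x : X} (g : TangentSpace J x →L[ℝ] ℝ) :
    ∃ l : X → ℝ, ContMDiffAt J 𝓘(ℝ, ℝ) 1 l x ∧ mfderiv J 𝓘(ℝ, ℝ) l x = g := by
  let g' : E →L[ℝ] ℝ := g
  refine ⟨g' ∘ extChartAt J x, g'.contMDiff.contMDiffAt.comp x contMDiffAt_extChartAt, ?_⟩
  rw [mfderiv_comp x g'.differentiableAt.mdifferentiableAt
    ((contMDiffAt_extChartAt (n := 1)).mdifferentiableAt one_ne_zero), mfderiv_extChartAt_self, mfderiv_eq_fderiv,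
    g'.fderiv]
  rfl
end
section
variable {EX HX EY HY : Type*}
  [NormedAddCommGroup EX] [NormedSpace ℝ EX] [TopologicalSpace HX]
  [NormedAddCommGroup EY] [NormedSpace ℝ EY] [TopologicalSpace HY]
  {IX : ModelWithCorners ℝ EX HX} {IY : ModelWithCorners ℝ EY HY}
  {X Y : Type*}
  [TopologicalSpace X] [ChartedSpace HX X]
  [TopologicalSpace Y] [ChartedSpace HY Y]
  [RiemannianBundle (fun x : X => TangentSpace IX x)]
  [RiemannianBundle (fun y : Y => TangentSpace IY y)]
  [IsManifold IX 1 X] [IsManifold IY 1 Y]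
  [IsContinuousRiemannianBundle EX (fun x : X => TangentSpace IX x)]
  [IsContinuousRiemannianBundle EY (fun x : Y => TangentSpace IY x)]

lemma riceCondition_le [RegularSpace X] {f : X → Y} {x : X}
    (hf : ContMDiffAt IX IY 1 f x) : riceCondition IX IY f x ≤ ‖mfderiv IX IY f x‖ₑ := by
  refine ENNReal.le_of_forall_pos_le_add fun η hη _ => ?_
  have hC : ‖mfderiv IX IY f x‖ < ((‖mfderiv IX IY f x‖₊ + η : ℝ≥0) : ℝ) := by
    have : (0 : ℝ) < η := hη
    push_cast
    exact lt_add_of_pos_right _ this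
  obtain ⟨δ, hδ, h⟩ := exists_riemannianEDist_map_le hf hC
  obtain ⟨ε, hε, hεδ⟩ := exists_between hδ
  refine (iInf₂_le ε hε).trans (iSup₂_le fun x' hx' => ?_)
  exact ENNReal.div_le_of_le_mul (h x' (hx'.trans_lt hεδ))

/-- With a curve `γ` of velocity `v` and a function `l` whose differential norms `Df v`, the real
function `l ∘ f ∘ γ` is Lipschitz at `0` and has derivative `‖Df v‖` there. -/
lemma norm_mfderiv_apply_le_of_edist_le [IX.Boundaryless] [RegularSpace X] [RegularSpace Y]
    {f : X → Y} {x : X}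
    (hf : ContMDiffAt IX IY 1 f x) {ε : ℝ≥0∞} (hε : 0 < ε) {K : ℝ≥0}
    (hK : ∀ x', riemannianEDist IX x x' ≤ ε →
      riemannianEDist IY (f x) (f x') ≤ K * riemannianEDist IX x x')
    (v : TangentSpace IX x) : ‖mfderiv IX IY f x v‖ ≤ K * ‖v‖ := by
  -- The local Lipschitz bounds for `γ` and `l` need constants strictly above `‖v‖` and `1`; the
  -- slack tends to zero at the end.
  suffices H : ∀ c₁ c₂ : ℝ≥0, ‖v‖ < c₁ → 1 < c₂ → ‖mfderiv IX IY f x v‖ ≤ c₂ * (K * c₁) by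
    have ht : Tendsto (fun r : ℝ => (1 + r) * (K * (‖v‖ + r))) (𝓝[>] 0)
        (𝓝 ((1 + 0) * (K * (‖v‖ + 0)))) :=
      (Continuous.tendsto (by fun_prop) _).mono_left nhdsWithin_le_nhds
    rw [add_zero, add_zero, one_mul] at ht
    refine ge_of_tendsto ht (eventually_nhdsWithin_of_forall fun r (hr : 0 < r) => ?_)
    have h1 : 0 ≤ ‖v‖ := norm_nonneg _
    have := H ⟨‖v‖ + r, by positivity⟩ ⟨1 + r, by positivity⟩ (lt_add_of_pos_right _ hr)
      (show (1 : ℝ) < 1 + r by linarith)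
    exact this
  intro c₁ c₂ hc₁ hc₂
  obtain ⟨γ, rfl, hγ, hγv⟩ := exists_curve_mfderiv_eq v
  obtain ⟨g, hg1, hgv⟩ := exists_dual_vector'' ℝ (mfderiv IX IY f (γ 0) v)
  obtain ⟨l, hl, hlg⟩ := exists_mfderiv_eq_functional g
  have hγn : ‖mfderiv 𝓘(ℝ, ℝ) IX γ 0‖ < c₁ := by
    refine lt_of_le_of_lt (ContinuousLinearMap.opNorm_le_bound _ (norm_nonneg v) fun t => ?_) hc₁
    have : mfderiv 𝓘(ℝ, ℝ) IX γ 0 t = (show ℝ from t) • v := by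
      rw [← hγv]
      have h2 : t = (show ℝ from t) • (1 : ℝ) := (mul_one (show ℝ from t)).symm
      conv_lhs => rw [h2]
      exact (mfderiv 𝓘(ℝ, ℝ) IX γ 0).map_smul _ _
    rw [this, norm_smul, mul_comm, norm_tangentSpace_vectorSpace]
  have hln : ‖mfderiv IY 𝓘(ℝ, ℝ) l (f (γ 0))‖ < c₂ := by
    refine lt_of_le_of_lt (ContinuousLinearMap.opNorm_le_bound _ zero_le_one fun w => ?_)
      (show (1 : ℝ) < c₂ from hc₂)
    rw [hlg, norm_tangentSpace_vectorSpace]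
    exact g.le_of_opNorm_le hg1 w
  obtain ⟨δ₁, hδ₁, h₁⟩ := exists_riemannianEDist_map_le hγ hγn
  obtain ⟨δ₂, hδ₂, h₂⟩ := exists_riemannianEDist_map_le hl hln
  simp only [← IsRiemannianManifold.out (I := 𝓘(ℝ, ℝ))] at h₁ h₂
  have e0 : Tendsto (fun t : ℝ => edist 0 t) (𝓝 0) (𝓝 0) := by
    simpa using (tendsto_const_nhds (x := (0 : ℝ))).edist (tendsto_id (α := ℝ) (x := 𝓝 0))
  have e1 : Tendsto (fun t : ℝ => c₁ * edist 0 t) (𝓝 0) (𝓝 0) := by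
    simpa using ENNReal.Tendsto.const_mul e0 (.inr ENNReal.coe_ne_top)
  have e2 : Tendsto (fun t : ℝ => K * (c₁ * edist 0 t)) (𝓝 0) (𝓝 0) := by
    simpa using ENNReal.Tendsto.const_mul e1 (.inr ENNReal.coe_ne_top)
  have hlip : ∀ᶠ t in 𝓝 (0 : ℝ), ‖(l ∘ f ∘ γ) t - (l ∘ f ∘ γ) 0‖ ≤ c₂ * (K * c₁) * ‖t - 0‖ := by
    filter_upwards [e0.eventually_lt_const hδ₁, e1.eventually_lt_const hε,
      e2.eventually_lt_const hδ₂] with t ht0 ht1 ht2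
    have k1 := h₁ t ht0
    have k2 := (hK (γ t) (k1.trans ht1.le)).trans (mul_le_mul' le_rfl k1)
    have k3 := (h₂ (f (γ t)) (k2.trans_lt ht2)).trans (mul_le_mul' le_rfl k2)
    rw [edist_nndist, edist_nndist] at k3
    norm_cast at k3
    rw [← dist_eq_norm, ← dist_eq_norm, dist_comm, dist_comm t, ← coe_nndist, ← coe_nndist,
      mul_assoc, mul_assoc]
    exact_mod_cast k3
  have hd := (((hl.mdifferentiableAt one_ne_zero).hasMFDerivAt.comp (γ 0)
    (hf.mdifferentiableAt one_ne_zero).hasMFDerivAt).comp 0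
    (hγ.mdifferentiableAt one_ne_zero).hasMFDerivAt).hasFDerivAt
  have hb := hd.le_of_lip' (by positivity) hlip
  have hb1 := ContinuousLinearMap.le_of_opNorm_le _ hb (1 : ℝ)
  rw [norm_one, mul_one] at hb1
  refine le_trans (le_of_eq ?_) hb1
  have : ((mfderiv IY 𝓘(ℝ, ℝ) l (f (γ 0)) ∘L mfderiv IX IY f (γ 0)) ∘L
      mfderiv 𝓘(ℝ, ℝ) IX γ 0) (1 : ℝ) = g (mfderiv IX IY f (γ 0) v) := by
    rw [← hγv, ← hlg]
    rfl
  refine Eq.trans ?_ (congrArg (norm (E := ℝ)) this).symm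
  rw [hgv]
  simp

theorem riceCondition_eq [IX.Boundaryless] [RegularSpace X] [RegularSpace Y]
    {f : X → Y} {x : X} (hf : ContMDiffAt IX IY 1 f x) :
    riceCondition IX IY f x = operatorSpectralNorm IX IY (mfderiv IX IY f x) := by
  refine le_antisymm ((riceCondition_le hf).trans_eq (operatorSpectralNorm_eq_enorm _).symm) ?_
  refine le_iInf₂ fun ε hε => iSup₂_le fun v hv => ?_
  obtain ⟨K, hKdef⟩ : ∃ K : ℝ≥0∞, K = ⨆ (x' : X) (_ : riemannianEDist IX x x' ≤ ε),
    riemannianEDist IY (f x) (f x') / riemannianEDist IX x x' := ⟨_, rfl⟩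
  rw [← hKdef]
  rcases eq_or_ne K ⊤ with hK | hK
  · rw [hK]; exact le_top
  lift K to ℝ≥0 using hK
  refine ENNReal.div_le_of_le_mul ?_
  -- The cap at `1` keeps the distance finite, since a quotient by `∞` is `0` and carries no
  -- information.
  have hε' : 0 < min ε 1 := lt_min hε zero_lt_one
  have h := norm_mfderiv_apply_le_of_edist_le hf hε' (K := K) (fun x' hx' => ?_) v
  · have h' : ‖mfderiv IX IY f x v‖₊ ≤ K * ‖v‖₊ := h
    simp only [enorm]
    exact_mod_cast h'
  · have h1 : riemannianEDist IY (f x) (f x') / riemannianEDist IX x x' ≤ K := by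
      rw [hKdef]
      exact le_iSup₂ (f := fun (x' : X) (_ : riemannianEDist IX x x' ≤ ε) =>
        riemannianEDist IY (f x) (f x') / riemannianEDist IX x x') x'
        (hx'.trans (min_le_left _ _))
    refine (ENNReal.div_le_iff_le_mul (.inr ENNReal.coe_ne_top) (.inl ?_)).1 h1
    exact ((hx'.trans (min_le_right _ _)).trans_lt ENNReal.one_lt_top).ne

end

/-! ### Tangent spaces by curves, and local inverses. -/

section
variable {E H : Type*} [NormedAddCommGroup E] [NormedSpace ℝ E] [TopologicalSpace H]
  {J : ModelWithCorners ℝ E H} {X : Type*} [TopologicalSpace X] [ChartedSpace H X]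
  {E' H' : Type*} [NormedAddCommGroup E'] [NormedSpace ℝ E'] [TopologicalSpace H']
  {J' : ModelWithCorners ℝ E' H'} {M : Type*} [TopologicalSpace M] [ChartedSpace H' M]

/-- Curves in `curveTangentSpace` must stay in the set for all times. Reparametrizing by `δ sin (t /
δ)` confines a locally defined curve without changing its velocity at `0`. -/
lemma exists_contDiff_small (δ : ℝ) (hδ : 0 < δ) :
    ∃ ρ : ℝ → ℝ, ContDiff ℝ ∞ ρ ∧ ρ 0 = 0 ∧ HasDerivAt ρ 1 0 ∧ ∀ t, |ρ t| ≤ δ := by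
  refine ⟨fun t => δ * Real.sin (δ⁻¹ * t), by fun_prop, by simp, ?_, fun t => ?_⟩
  · have := (((hasDerivAt_id (0 : ℝ)).const_mul δ⁻¹).sin).const_mul δ
    simpa [hδ.ne'] using this
  · rw [abs_mul, abs_of_pos hδ]
    exact mul_le_of_le_one_right hδ.le (Real.abs_sin_le_one _)

lemma mfderiv_mem_curveTangentSpace [J.Boundaryless] [IsManifold J ∞ X] {A : Set M} {φ : X → M} {x : X}
    (hφ : ∀ᶠ x' in 𝓝 x, ContMDiffAt J J' ∞ φ x') (hA : ∀ᶠ x' in 𝓝 x, φ x' ∈ A)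
    (v : TangentSpace J x) : mfderiv J J' φ x v ∈ curveTangentSpace J' A (φ x) := by
  let w : E := v
  let l : ℝ → E := fun t => extChartAt J x x + t • w
  have hl : HasFDerivAt l ((ContinuousLinearMap.id ℝ ℝ).smulRight w) 0 :=
    ((hasFDerivAt_id (0 : ℝ)).smul_const w).const_add _
  have hl0 : l 0 = extChartAt J x x := by simp [l]
  have hlc : ContMDiff 𝓘(ℝ, ℝ) 𝓘(ℝ, E) ∞ l := by
    rw [contMDiff_iff_contDiff]
    fun_prop
  have hev : ∀ᶠ t in 𝓝 (0 : ℝ), l t ∈ (extChartAt J x).target ∧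
      ContMDiffAt J J' ∞ φ ((extChartAt J x).symm (l t)) ∧ φ ((extChartAt J x).symm (l t)) ∈ A := by
    have hc : Tendsto l (𝓝 0) (𝓝 (extChartAt J x x)) := hl0 ▸ hlc.continuous.tendsto 0
    have hc' : Tendsto (fun t => (extChartAt J x).symm (l t)) (𝓝 0) (𝓝 x) := by
      have := (continuousAt_extChartAt_symm (I := J) x).tendsto.comp hc
      rwa [extChartAt_to_inv] at this
    exact (hc.eventually (extChartAt_target_mem_nhds x)).and (hc'.eventually (hφ.and hA))
  obtain ⟨δ, hδ, hball⟩ := Metric.eventually_nhds_iff.1 hev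
  obtain ⟨ρ, hρ, hρ0, hρ1, hρδ⟩ := exists_contDiff_small (δ / 2) (half_pos hδ)
  have hall : ∀ t, _ := fun t => hball (y := ρ t) (by
    rw [dist_zero_right, Real.norm_eq_abs]; exact (hρδ t).trans_lt (half_lt_self hδ))
  have hs : ∀ t, ContMDiffAt 𝓘(ℝ, E) J ∞ (extChartAt J x).symm (l (ρ t)) := fun t =>
    contMDiffAt_extChartAt_symm_of_mem (hall t).1
  refine Submodule.subset_span ⟨fun t => φ ((extChartAt J x).symm (l (ρ t))), fun t => ?_, ?_,
    fun t => (hall t).2.2, ?_⟩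
  · exact (hall t).2.1.comp t ((hs t).comp t (hlc.contMDiffAt.comp t hρ.contMDiff.contMDiffAt))
  · simp [hρ0, hl0]
  · have h1 : HasMFDerivAt 𝓘(ℝ, ℝ) 𝓘(ℝ, E) (fun t => l (ρ t)) 0
        (ContinuousLinearMap.toSpanSingleton ℝ w) := by
      rw [← hρ0] at hl
      have hd : HasDerivAt (fun t => l (ρ t)) w 0 := by
        simpa [Function.comp_def] using hl.comp_hasDerivAt 0 hρ1
      exact hd.hasFDerivAt.hasMFDerivAt
    have h2 : HasMFDerivAt 𝓘(ℝ, E) J (extChartAt J x).symm (l (ρ 0)) (ContinuousLinearMap.id ℝ E) := by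
      have := ((hs 0).mdifferentiableAt (by simp)).hasMFDerivAt
      rw [hρ0, hl0, mfderiv_extChartAt_symm_self] at this
      rwa [hρ0, hl0]
    have e : (extChartAt J x).symm (l (ρ 0)) = x := by simp [hρ0, hl0]
    have h3 : HasMFDerivAt J J' φ ((extChartAt J x).symm (l (ρ 0))) (mfderiv J J' φ x) := by
      have := ((hall 0).2.1.mdifferentiableAt (by simp)).hasMFDerivAt
      rwa [e] at this ⊢
    have h4 := (h3.comp (0 : ℝ) (h2.comp (0 : ℝ) h1)).mfderiv
    refine (congrArg (fun L : ℝ →L[ℝ] E' => L 1) h4).trans ?_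
    change (mfderiv J J' φ x) ((1 : ℝ) • w) = mfderiv J J' φ x v
    rw [one_smul]
end

section
variable {E H : Type*} [NormedAddCommGroup E] [NormedSpace ℝ E] [TopologicalSpace H]
  {J : ModelWithCorners ℝ E H} {X : Type*} [TopologicalSpace X] [ChartedSpace H X]
  {E' H' : Type*} [NormedAddCommGroup E'] [NormedSpace ℝ E'] [TopologicalSpace H']
  {J' : ModelWithCorners ℝ E' H'} {M : Type*} [TopologicalSpace M] [ChartedSpace H' M]
  {A : Set M} {p : M → X} {z : M} {φ : X → M}

variable (J J') in
/-- A local inverse of `p` on `A` that is smooth at every point near `p z`. -/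
structure IsSmoothLocalInverseOn (A : Set M) (p : M → X) (z : M) (φ : X → M) : Prop where
  smooth : ∀ᶠ x in 𝓝 (p z), ContMDiffAt J J' ∞ φ x
  base : φ (p z) = z
  right_inv : ∀ᶠ x in 𝓝 (p z), φ x ∈ A ∧ p (φ x) = x
  left_inv : ∀ᶠ w in 𝓝[A] z, φ (p w) = w

namespace IsSmoothLocalInverseOn

lemma contMDiffAt (h : IsSmoothLocalInverseOn J J' A p z φ) : ContMDiffAt J J' ∞ φ (p z) :=
  h.smooth.self_of_nhds

lemma isLocalInverseOn (h : IsSmoothLocalInverseOn J J' A p z φ) : IsLocalInverseOn J J' A p z φ :=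
  ⟨h.contMDiffAt, h.base, h.right_inv, h.left_inv⟩

lemma tendsto (h : IsSmoothLocalInverseOn J J' A p z φ) : Tendsto φ (𝓝 (p z)) (𝓝 z) := by
  simpa [ContinuousAt, h.base] using h.contMDiffAt.continuousAt

lemma tendsto_nhdsWithin (h : IsSmoothLocalInverseOn J J' A p z φ) :
    Tendsto φ (𝓝 (p z)) (𝓝[A] z) :=
  tendsto_nhdsWithin_iff.2 ⟨h.tendsto, h.right_inv.mono fun _ hx => hx.1⟩

lemma eventuallyEq (h : IsSmoothLocalInverseOn J J' A p z φ) {ψ : X → M}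
    (hψ : IsLocalInverseOn J J' A p z ψ) : ψ =ᶠ[𝓝 (p z)] φ := by
  filter_upwards [h.tendsto_nhdsWithin.eventually hψ.left_inv, h.right_inv] with x h1 h2
  rwa [h2.2] at h1

/-- All the conditions are open, so the same `φ` is a local inverse at nearby solutions too. This is
what puts nearby triples in the well-posed locus. -/
lemma eventually (h : IsSmoothLocalInverseOn J J' A p z φ) :
    ∀ᶠ x in 𝓝 (p z), IsSmoothLocalInverseOn J J' A p (φ x) φ := by
  filter_upwards [h.smooth.eventually_nhds, h.right_inv, h.right_inv.eventually_nhds,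
    h.tendsto_nhdsWithin.eventually (eventually_eventually_nhdsWithin.2 h.left_inv)]
    with x h1 h2 h3 h4
  exact ⟨h2.2.symm ▸ h1, by rw [h2.2], h2.2.symm ▸ h3, h4⟩

lemma mfderiv_comp_mfderiv (h : IsSmoothLocalInverseOn J J' A p z φ)
    (hp : MDifferentiableAt J' J p z) (v : TangentSpace J (p z)) :
    mfderiv J' J p z (mfderiv J J' φ (p z) v) = v := by
  have hp' : MDifferentiableAt J' J p (φ (p z)) := by rwa [h.base]
  have hc := (mfderiv_comp (p z) hp' (h.contMDiffAt.mdifferentiableAt (by simp))).symm.trans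
    (show p ∘ φ =ᶠ[𝓝 (p z)] id from h.right_inv.mono fun _ hx => hx.2).mfderiv_eq
  have e : (mfderiv J' J p (φ (p z)) : E' →L[ℝ] E) = mfderiv J' J p z := by rw [h.base]
  rw [mfderiv_id] at hc
  have := congrArg (fun L : E →L[ℝ] E => L v) hc
  exact (congrArg (fun L : E' →L[ℝ] E => L (mfderiv J J' φ (p z) v)) e).symm.trans this

/-- `Dφ` inverts `Dp` on both sides. That `Dφ ∘ Dp` is the identity on the tangent space need only
be checked on velocities of curves in `A`, where `φ ∘ p ∘ γ = γ` near `0`; that `Dφ` lands in the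
tangent space uses smoothness of `φ` near `p z`. -/
lemma derivInvertibleOn [J.Boundaryless] [IsManifold J ∞ X]
    (h : IsSmoothLocalInverseOn J J' A p z φ) (hp : MDifferentiableAt J' J p z) :
    DerivInvertibleOn J J' A p z := by
  have hleft : ∀ v ∈ curveTangentSpace J' A z,
      (mfderiv J J' φ (p z) (mfderiv J' J p z v) : E') = v := by
    intro v hv
    induction hv using Submodule.span_induction with
    | zero => simp; rfl
    | add v w _ _ hv hw => rw [map_add, map_add, hv, hw]; rfl
    | smul c v _ hv => rw [map_smul, map_smul, hv]; rfl
    | mem v hv =>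
      obtain ⟨γ, hγ, rfl, hγA, rfl⟩ := hv
      have hγ0 := hγ.mdifferentiableAt (by simp) (x := (0 : ℝ))
      have hev : φ ∘ p ∘ γ =ᶠ[𝓝 0] γ :=
        (tendsto_nhdsWithin_iff.2 ⟨hγ.continuous.tendsto 0, .of_forall hγA⟩).eventually h.left_inv
      have hc := ((h.contMDiffAt.mdifferentiableAt (by simp)).hasMFDerivAt.comp (0 : ℝ)
        (hp.hasMFDerivAt.comp (0 : ℝ) hγ0.hasMFDerivAt)).mfderiv
      have hc' := hev.mfderiv_eq (I := 𝓘(ℝ, ℝ)) (I' := J')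
      exact congrArg (fun L : ℝ →L[ℝ] E' => L 1) (hc.symm.trans hc')
  refine ⟨fun v w hvw => ?_, fun v => ?_⟩
  · have : mfderiv J' J p z v = mfderiv J' J p z w := hvw
    exact Subtype.ext (by rw [← hleft v v.2, this, hleft w w.2])
  · refine ⟨⟨mfderiv J J' φ (p z) v, ?_⟩, h.mfderiv_comp_mfderiv hp v⟩
    have := mfderiv_mem_curveTangentSpace h.smooth (h.right_inv.mono fun _ hx => hx.1) v
    rwa [h.base] at this

end IsSmoothLocalInverseOn
end

/-! ### Condition numbers from local inverses, and the inverse function theorem on manifolds. -/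

section
variable {E H : Type*} [NormedAddCommGroup E] [NormedSpace ℝ E] [TopologicalSpace H]
  {J : ModelWithCorners ℝ E H} {X : Type*} [TopologicalSpace X] [ChartedSpace H X]
  {E' H' : Type*} [NormedAddCommGroup E'] [NormedSpace ℝ E'] [TopologicalSpace H']
  {J' : ModelWithCorners ℝ E' H'} {M : Type*} [TopologicalSpace M] [ChartedSpace H' M]
  {F G : Type*} [NormedAddCommGroup F] [NormedSpace ℝ F] [TopologicalSpace G]
  {K : ModelWithCorners ℝ F G} {Y : Type*} [TopologicalSpace Y] [ChartedSpace G Y]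
  {A : Set M} {p : M → X} {q : M → Y} {z : M} {φ : X → M}

lemma operatorSpectralNorm_lt_top [RiemannianBundle (fun x : X => TangentSpace J x)]
    [RiemannianBundle (fun y : Y => TangentSpace K y)] {x : X} {y : Y}
    (L : TangentSpace J x →L[ℝ] TangentSpace K y) : operatorSpectralNorm J K L < ⊤ := by
  rw [operatorSpectralNorm_eq_enorm]
  exact enorm_lt_top

/-- The tangent spaces at `f x` and `g x` are different types with their own norms, so base point
and derivative are replaced together. -/
lemma operatorSpectralNorm_mfderiv_congr [RiemannianBundle (fun x : X => TangentSpace J x)]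
    [RiemannianBundle (fun y : Y => TangentSpace K y)] {f g : X → Y} {x : X} (h : f =ᶠ[𝓝 x] g) :
    operatorSpectralNorm J K (mfderiv J K f x) = operatorSpectralNorm J K (mfderiv J K g x) := by
  let N : Y → (E →L[ℝ] F) → ℝ≥0∞ := fun y L => operatorSpectralNorm J K (x := x) (y := y) L
  have hL : (mfderiv J K f x : E →L[ℝ] F) = mfderiv J K g x := h.mfderiv_eq
  exact congrArg₂ N h.self_of_nhds hL

theorem IsSmoothLocalInverseOn.conditionNumber_eq
    [RiemannianBundle (fun x : X => TangentSpace J x)]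
    [RiemannianBundle (fun y : Y => TangentSpace K y)]
    [IsManifold J ∞ X] [IsManifold K ∞ Y]
    [IsContinuousRiemannianBundle E (fun x : X => TangentSpace J x)]
    [IsContinuousRiemannianBundle F (fun x : Y => TangentSpace K x)]
    [J.Boundaryless] [RegularSpace X] [RegularSpace Y]
    (h : IsSmoothLocalInverseOn J J' A p z φ) (hp : MDifferentiableAt J' J p z)
    (hq : ContMDiffAt J' K 1 q z) :
    conditionNumber J K J' A p q z = operatorSpectralNorm J K (mfderiv J K (q ∘ φ) (p z)) := by
  have : IsManifold J 1 X := .of_le (n := ∞) (by simp)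
  have : IsManifold K 1 Y := .of_le (n := ∞) (by simp)
  rw [conditionNumber, if_pos (h.derivInvertibleOn hp)]
  have key : ∀ ψ, IsLocalInverseOn J J' A p z ψ → riceCondition J K (q ∘ ψ) (p z) =
      operatorSpectralNorm J K (mfderiv J K (q ∘ φ) (p z)) := by
    intro ψ hψ
    have hs : ContMDiffAt J K 1 (q ∘ ψ) (p z) := by
      refine ContMDiffAt.comp _ ?_ (hψ.smooth.of_le (by simp))
      rwa [hψ.base]
    rw [riceCondition_eq hs]
    exact operatorSpectralNorm_mfderiv_congr ((h.eventuallyEq hψ).fun_comp q)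
  refine le_antisymm ?_ (le_iInf₂ fun ψ hψ => (key ψ hψ).ge)
  exact (iInf₂_le φ h.isLocalInverseOn).trans_eq (key φ h.isLocalInverseOn)

/-- The inverse function theorem in charts. Smoothness is needed at all points near `f z`: `C^∞` at
a point only provides, for each finite order, a neighbourhood that may depend on the order. -/
lemma exists_isSmoothLocalInverseOn_univ [J.Boundaryless] [J'.Boundaryless]
    [IsManifold J ∞ X] [IsManifold J' ∞ M] [CompleteSpace E']
    {f : M → X} (hf : ∀ᶠ w in 𝓝 z, ContMDiffAt J' J ∞ f w)
    (hinv : (mfderiv J' J f z).IsInvertible) : ∃ σ, IsSmoothLocalInverseOn J J' univ f z σ := by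
  have : IsManifold J 1 X := .of_le (n := ∞) (by simp)
  have : IsManifold J' 1 M := .of_le (n := ∞) (by simp)
  let a := extChartAt J' z
  let b := extChartAt J (f z)
  let g : E' → E := b ∘ f ∘ a.symm
  have hfc : ContinuousAt f z := hf.self_of_nhds.continuousAt
  have ha0 : a.symm (a z) = z := extChartAt_to_inv z
  have ha_tend : Tendsto a.symm (𝓝 (a z)) (𝓝 z) := by
    have := continuousAt_extChartAt_symm (I := J') z
    rwa [ContinuousAt, extChartAt_to_inv] at this
  have hg : ∀ᶠ u in 𝓝 (a z), ContDiffAt ℝ ∞ g u := by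
    filter_upwards [ha_tend.eventually hf, extChartAt_target_mem_nhds (I := J') z,
      ha_tend.eventually (hfc (extChartAt_source_mem_nhds (I := J) (f z)))] with u h1 h2 h3
    rw [← contMDiffAt_iff_contDiffAt]
    exact (contMDiffAt_extChartAt' (by simpa using! h3)).comp u
      (h1.comp u (contMDiffAt_extChartAt_symm_of_mem h2))
  have hfd : fderiv ℝ g (a z) = mfderiv J' J f z := by
    have h1 := (hf.self_of_nhds.mdifferentiableAt (by simp)).hasMFDerivAt.2
    rw [J'.range_eq_univ] at h1
    let L : E' →L[ℝ] E := mfderiv J' J f z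
    have h2 : HasFDerivAt g L (a z) := hasFDerivWithinAt_univ.1 h1
    exact h2.fderiv
  obtain ⟨D, hD⟩ : ∃ D : E' ≃L[ℝ] E, (D : E' →L[ℝ] E) = fderiv ℝ g (a z) := by
    obtain ⟨D, hD⟩ := hinv
    exact ⟨D, by rw [hfd]; exact hD⟩
  have hg0 := hg.self_of_nhds
  have hgD : HasFDerivAt g (D : E' →L[ℝ] E) (a z) := by
    rw [hD]
    exact (hg0.differentiableAt (by simp)).hasFDerivAt
  let e := hg0.toOpenPartialHomeomorph g hgD (by simp)
  have hes : a z ∈ e.source := hg0.mem_toOpenPartialHomeomorph_source hgD (by simp)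
  have heq : ∀ u, e u = g u := fun _ => rfl
  have hga : g (a z) = b (f z) := by simp only [g, Function.comp_apply, ha0]
  have het : b (f z) ∈ e.target := hga ▸ e.map_source hes
  have hes0 : e.symm (b (f z)) = a z := by
    rw [← hga]; exact e.left_inv hes
  have hb_tend : Tendsto b (𝓝 (f z)) (𝓝 (b (f z))) := continuousAt_extChartAt (I := J) (f z)
  have he_tend : Tendsto e.symm (𝓝 (b (f z))) (𝓝 (a z)) := by
    have := e.continuousAt_symm het
    rwa [ContinuousAt, hes0] at this
  -- Invertibility of the derivative is open, which makes the inverse smooth at every nearby point.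
  have hinv' : ∀ᶠ u in 𝓝 (a z), ∃ D' : E' ≃L[ℝ] E, (D' : E' →L[ℝ] E) = fderiv ℝ g u := by
    have hc : ContinuousAt (fderiv ℝ g) (a z) := (hg0.fderiv_right (m := 0) (by simp)).continuousAt
    have hD' := ContinuousLinearEquiv.nhds D
    rw [hD] at hD'
    exact hc.tendsto.eventually hD'
  refine ⟨fun x => a.symm (e.symm (b x)), ?_, ?_, ?_, ?_⟩
  · filter_upwards [hb_tend.eventually (he_tend.eventually (hg.and (hinv'.and
      (extChartAt_target_mem_nhds (I := J') z)))), extChartAt_source_mem_nhds (I := J) (f z),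
      hb_tend.eventually (e.open_target.mem_nhds het)] with x h1 h2 h3
    obtain ⟨h1, ⟨D', hD'⟩, h4⟩ := h1
    have hsymm : ContDiffAt ℝ ∞ e.symm (b x) := by
      refine e.contDiffAt_symm h3 (f₀' := D') ?_ h1
      rw [hD']
      exact (h1.differentiableAt (by simp)).hasFDerivAt
    exact (contMDiffAt_extChartAt_symm_of_mem h4).comp x
      (hsymm.contMDiffAt.comp x (contMDiffAt_extChartAt' (by simpa using! h2)))
  · rw [hes0, ha0]
  · have ht : Tendsto (fun x => e.symm (b x)) (𝓝 (f z)) (𝓝 (a z)) := he_tend.comp hb_tend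
    filter_upwards [extChartAt_source_mem_nhds (I := J) (f z),
      hb_tend.eventually (e.open_target.mem_nhds het), ht.eventually (ha_tend.eventually
        (hfc (extChartAt_source_mem_nhds (I := J) (f z))))] with x h1 h2 h3
    refine ⟨mem_univ _, b.injOn h3 h1 ?_⟩
    exact e.right_inv h2
  · rw [nhdsWithin_univ]
    filter_upwards [extChartAt_source_mem_nhds (I := J') z,
      (continuousAt_extChartAt (I := J') z).eventually (e.open_source.mem_nhds hes)] with w h1 h2
    have : e (a w) = b (f w) := by
      change b (f (a.symm (a w))) = b (f w)
      rw [a.left_inv h1]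
    rw [← this, e.left_inv h2, a.left_inv h1]
end

/-! ### Derivatives of immersions. -/

lemma isInvertible_of_injective {V W : Type*} [NormedAddCommGroup V] [NormedSpace ℝ V]
    [NormedAddCommGroup W] [NormedSpace ℝ W] [FiniteDimensional ℝ V] [FiniteDimensional ℝ W]
    (hVW : Module.finrank ℝ V = Module.finrank ℝ W) {L : V →L[ℝ] W} (hL : Function.Injective L) :
    L.IsInvertible :=
  ⟨(LinearEquiv.ofInjectiveOfFinrankEq L.toLinearMap hL hVW).toContinuousLinearEquiv, by
    ext v; rfl⟩

section
variable {E H : Type*} [NormedAddCommGroup E] [NormedSpace ℝ E] [TopologicalSpace H]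
  {J : ModelWithCorners ℝ E H} {X : Type*} [TopologicalSpace X] [ChartedSpace H X]
  {E' H' : Type*} [NormedAddCommGroup E'] [NormedSpace ℝ E'] [TopologicalSpace H']
  {J' : ModelWithCorners ℝ E' H'} {M : Type*} [TopologicalSpace M] [ChartedSpace H' M]

/-- In the adapted charts `f` is `u ↦ (u, 0)`, so the first coordinate is a differentiable local
left inverse. -/
lemma IsImmersionAt.mfderiv_injective [J.Boundaryless] [IsManifold J ∞ X] [IsManifold J' ∞ M]
    {f : X → M} {x : X} (hf : IsImmersionAt J J' ∞ f x) : Function.Injective (mfderiv J J' f x) := by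
  let c := hf.domChart.extend J
  let d := hf.codChart.extend J'
  let l : E' → E := fun u => (hf.equiv.symm u).1
  have hl : ContDiff ℝ ∞ l := by fun_prop
  have hxs : x ∈ hf.domChart.source := hf.mem_domChart_source
  have hd : MDifferentiableAt J' 𝓘(ℝ, E') d (f x) :=
    ((OpenPartialHomeomorph.contMDiffOn_extend hf.codChart_mem_maximalAtlas).contMDiffAt
      (hf.codChart.open_source.mem_nhds hf.mem_codChart_source)).mdifferentiableAt (by simp)
  have hld : ∀ w ∈ hf.domChart.source, l (d (f w)) = c w := by
    intro w hw
    have hw' : w ∈ c.source := by simpa [c] using hw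
    have h1 := hf.writtenInCharts (c.map_source hw')
    have h2 : d (f w) = hf.equiv (c w, 0) := by
      rw [← show _ = hf.equiv (c w, 0) from h1]
      change d (f w) = d (f (c.symm (c w)))
      rw [c.left_inv hw']
    simp only [l, h2, ContinuousLinearEquiv.symm_apply_apply]
  have hc : MDifferentiableAt 𝓘(ℝ, E) J c.symm (l (d (f x))) := by
    rw [hld x hxs]
    refine ((contMDiffOn_extend_symm
      hf.domChart_mem_maximalAtlas).contMDiffAt ?_).mdifferentiableAt (n := ∞) (by simp)
    rw [← OpenPartialHomeomorph.extend_target']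
    exact hf.domChart.isOpen_extend_target.mem_nhds (c.map_source (by simpa [c] using hxs))
  have hev : (c.symm ∘ l ∘ d) ∘ f =ᶠ[𝓝 x] id := by
    filter_upwards [hf.domChart.open_source.mem_nhds hxs] with w hw
    have hw' : w ∈ c.source := by simpa [c] using hw
    simp only [Function.comp_apply, id, hld w hw, c.left_inv hw']
  have hcd := hc.comp (f x) (hl.contMDiff.contMDiffAt.mdifferentiableAt (by simp) |>.comp (f x) hd)
  have hc := (mfderiv_comp x hcd (hf.contMDiffAt.mdifferentiableAt (by simp))).symm.trans
    hev.mfderiv_eq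
  rw [mfderiv_id] at hc
  have hv : ∀ v : E, _ = v := fun v => congrArg (fun L : E →L[ℝ] E => L v) hc
  intro v w hvw
  exact (hv v).symm.trans ((congrArg (mfderiv J' J (c.symm ∘ l ∘ d) (f x)) hvw).trans (hv w))

end

/-! ### Smooth dependence of the tangential projection on the base point. -/

section
variable {V W : Type*} [NormedAddCommGroup V] [InnerProductSpace ℝ V] [CompleteSpace V]
  [NormedAddCommGroup W] [InnerProductSpace ℝ W] [CompleteSpace W]

/-- The orthogonal projection onto the range of `B`, as a smooth expression in `B`. -/
def rangeProj (B : V →L[ℝ] W) : W →L[ℝ] W :=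
  B ∘L (ContinuousLinearMap.inverse (B.adjoint ∘L B)) ∘L B.adjoint

lemma isInvertible_adjoint_comp_self [FiniteDimensional ℝ V] {B : V →L[ℝ] W}
    (hB : Function.Injective B) : (B.adjoint ∘L B).IsInvertible := by
  refine isInvertible_of_injective rfl ((injective_iff_map_eq_zero _).2 fun v hv => ?_)
  have : inner ℝ (B v) (B v) = 0 := by
    rw [← ContinuousLinearMap.adjoint_inner_left]
    change inner ℝ ((B.adjoint ∘L B) v) v = 0
    rw [hv, inner_zero_left]
  exact (injective_iff_map_eq_zero _).1 hB v (inner_self_eq_zero.1 this)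

/-- The normal equations: `B† (w - B (B†B)⁻¹ B† w) = 0` says that the residual is orthogonal to the
range. -/
lemma rangeProj_eq_starProjection [FiniteDimensional ℝ V] {B : V →L[ℝ] W}
    (hB : Function.Injective B) (K : Submodule ℝ W) [K.HasOrthogonalProjection]
    (hK : LinearMap.range B.toLinearMap = K) : rangeProj B = K.starProjection := by
  subst hK
  ext w
  refine (Submodule.eq_starProjection_of_mem_of_inner_eq_zero ?_ ?_).symm
  · exact ⟨_, rfl⟩
  · rintro _ ⟨v, rfl⟩
    change inner ℝ (w - rangeProj B w) (B v) = 0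
    rw [← ContinuousLinearMap.adjoint_inner_left, map_sub]
    have : B.adjoint (rangeProj B w) = B.adjoint w :=
      (isInvertible_adjoint_comp_self hB).self_apply_inverse _
    rw [this, sub_self, inner_zero_left]

lemma contDiffAt_rangeProj [FiniteDimensional ℝ V] {B : V →L[ℝ] W}
    (hB : Function.Injective B) : ContDiffAt ℝ ∞ rangeProj B := by
  have h1 : ContDiff ℝ ∞ (fun B : V →L[ℝ] W => B.adjoint) :=
    (ContinuousLinearMap.adjoint (𝕜 := ℝ) (E := V) (F := W)).toContinuousLinearEquiv.contDiff
  have h2 : ContDiff ℝ ∞ (fun B : V →L[ℝ] W => B.adjoint ∘L B) := h1.clm_comp contDiff_id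
  have h3 : ContDiffAt ℝ ∞ (fun B : V →L[ℝ] W => ContinuousLinearMap.inverse (B.adjoint ∘L B)) B :=

    ContDiffAt.comp (g := ContinuousLinearMap.inverse) (f := fun B : V →L[ℝ] W => B.adjoint ∘L B) B
      (isInvertible_adjoint_comp_self hB).contDiffAt_map_inverse h2.contDiffAt
  exact contDiffAt_id.clm_comp (h3.clm_comp h1.contDiffAt)
end

section
variable {E H : Type*} [NormedAddCommGroup E] [NormedSpace ℝ E] [TopologicalSpace H]
  {J : ModelWithCorners ℝ E H} {X : Type*} [TopologicalSpace X] [ChartedSpace H X]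
  {F G : Type*} [NormedAddCommGroup F] [NormedSpace ℝ F] [NormedAddCommGroup G] [NormedSpace ℝ G]

lemma HasMFDerivAt.clm_apply {c : X → F →L[ℝ] G} {u : X → F} {s : X} {c' : E →L[ℝ] F →L[ℝ] G}
    {u' : E →L[ℝ] F} (hc : HasMFDerivAt J 𝓘(ℝ, F →L[ℝ] G) c s c')
    (hu : HasMFDerivAt J 𝓘(ℝ, F) u s u') :
    HasMFDerivAt J 𝓘(ℝ, G) (fun x => c x (u x)) s ((c s).comp u' + c'.flip (u s)) := by
  refine ⟨hc.1.clm_apply hu.1, ?_⟩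
  have h1 : HasFDerivWithinAt (fun e => c ((extChartAt J s).symm e)) c' (range J)
    (extChartAt J s s) := hc.2
  have h2 : HasFDerivWithinAt (fun e => u ((extChartAt J s).symm e)) u' (range J)
    (extChartAt J s s) := hu.2
  have h3 := h1.clm_apply h2
  simp only [extChartAt_to_inv] at h3
  exact h3

end

section
variable {n m : ℕ} {I : Set (EuclideanSpace ℝ (Fin n))} [ChartedSpace (EuclideanSpace ℝ (Fin m)) I]
  [IsManifold (𝓡 m) ∞ I]

lemma tangentIncl_injective
    (hI : IsSmoothEmbedding (𝓡 m) (𝓡 n) ∞ (Subtype.val : I → EuclideanSpace ℝ (Fin n)))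
    (x : I) : Function.Injective (tangentIncl (m := m) x) :=
  IsImmersionAt.mfderiv_injective (hI.isImmersion.isImmersionAt x)

lemma tangentIncl_tangentProj
    (hI : IsSmoothEmbedding (𝓡 m) (𝓡 n) ∞ (Subtype.val : I → EuclideanSpace ℝ (Fin n)))
    (x : I) (v : EuclideanSpace ℝ (Fin n)) :
    tangentIncl (m := m) x (tangentProj (m := m) x v) =
      (tangentSub (m := m) x).starProjection v := by
  let L : EuclideanSpace ℝ (Fin m) →L[ℝ] tangentSub (m := m) x :=
    (tangentIncl (m := m) x).codRestrict (tangentSub (m := m) x)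
      (fun v => LinearMap.mem_range_self (tangentIncl (m := m) x).toLinearMap v)
  have hL : L.IsInvertible := by
    let T : EuclideanSpace ℝ (Fin m) →ₗ[ℝ] EuclideanSpace ℝ (Fin n) := (tangentIncl (m := m) x).toLinearMap
    refine isInvertible_of_injective (LinearMap.finrank_range_of_inj (f := T) (tangentIncl_injective hI x)).symm ?_
    intro v w hvw
    exact tangentIncl_injective hI x (congrArg Subtype.val hvw)
  exact congrArg Subtype.val
    (hL.self_apply_inverse ((tangentSub (m := m) x).orthogonalProjectionOnto v))

lemma tangentProj_tangentIncl
    (hI : IsSmoothEmbedding (𝓡 m) (𝓡 n) ∞ (Subtype.val : I → EuclideanSpace ℝ (Fin n)))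
    (x : I) (w : TangentSpace (𝓡 m) x) :
    tangentProj (m := m) x (tangentIncl (m := m) x w) = w := by
  apply tangentIncl_injective hI x
  rw [tangentIncl_tangentProj hI, Submodule.starProjection_eq_self_iff]
  exact LinearMap.mem_range_self (tangentIncl (m := m) x).toLinearMap w

lemma tangentProj_eq_zero_iff
    (hI : IsSmoothEmbedding (𝓡 m) (𝓡 n) ∞ (Subtype.val : I → EuclideanSpace ℝ (Fin n)))
    (x : I) (v : EuclideanSpace ℝ (Fin n)) :
    tangentProj (m := m) x v = 0 ↔ v ∈ normalSub (m := m) x := by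
  rw [← (tangentIncl_injective hI x).eq_iff, tangentIncl_tangentProj hI, map_zero,
    Submodule.starProjection_apply_eq_zero_iff]
  rfl

/-- In a chart the tangent space is the range of the injective Jacobian of the parametrization `ψ`,
so the projection is `rangeProj` of a smooth family. -/
lemma contMDiff_starProjection_tangentSub
    (hI : IsSmoothEmbedding (𝓡 m) (𝓡 n) ∞ (Subtype.val : I → EuclideanSpace ℝ (Fin n)))
    : ContMDiff (𝓡 m)
    𝓘(ℝ, EuclideanSpace ℝ (Fin n) →L[ℝ] EuclideanSpace ℝ (Fin n)) ∞
    (fun x : I => (tangentSub (m := m) x).starProjection) := by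
  have : IsManifold (𝓡 m) 1 I := .of_le (n := ∞) (by simp)
  intro x₀
  let ψ : EuclideanSpace ℝ (Fin m) → EuclideanSpace ℝ (Fin n) := fun u =>
    (extChartAt (𝓡 m) x₀).symm u
  have hψ : ∀ u ∈ (extChartAt (𝓡 m) x₀).target, ContDiffAt ℝ ∞ ψ u := by
    intro u hu
    rw [← contMDiffAt_iff_contDiffAt]
    exact hI.contMDiff.contMDiffAt.comp u (contMDiffAt_extChartAt_symm_of_mem hu)
  have hd : ∀ u ∈ (extChartAt (𝓡 m) x₀).target, fderiv ℝ ψ u =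
      (tangentIncl (m := m) ((extChartAt (𝓡 m) x₀).symm u) ∘L
        mfderiv 𝓘(ℝ, EuclideanSpace ℝ (Fin m)) (𝓡 m) (extChartAt (𝓡 m) x₀).symm u :
        EuclideanSpace ℝ (Fin m) →L[ℝ] EuclideanSpace ℝ (Fin n)) := by
    intro u hu
    rw [← mfderiv_eq_fderiv]
    exact mfderiv_comp u (hI.contMDiff.mdifferentiableAt (by simp))
      ((contMDiffAt_extChartAt_symm_of_mem (n := ∞) hu).mdifferentiableAt (by simp))
  have hbij : ∀ u ∈ (extChartAt (𝓡 m) x₀).target, Function.Bijective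
      (mfderiv 𝓘(ℝ, EuclideanSpace ℝ (Fin m)) (𝓡 m) (extChartAt (𝓡 m) x₀).symm u) := by
    intro u hu
    have := isInvertible_mfderivWithin_extChartAt_symm (I := 𝓡 m) hu
    rw [(𝓡 m).range_eq_univ, mfderivWithin_univ] at this
    exact this.bijective
  have hinj : ∀ u ∈ (extChartAt (𝓡 m) x₀).target, Function.Injective (fderiv ℝ ψ u) := by
    intro u hu
    rw [hd u hu]
    exact (tangentIncl_injective hI _).comp (hbij u hu).injective
  have hrange : ∀ u ∈ (extChartAt (𝓡 m) x₀).target, LinearMap.range (fderiv ℝ ψ u).toLinearMap =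
      tangentSub (m := m) ((extChartAt (𝓡 m) x₀).symm u) := by
    intro u hu
    rw [hd u hu]
    exact LinearMap.range_comp_of_range_eq_top _ (LinearMap.range_eq_top.2 (hbij u hu).surjective)
  have heq : (fun x : I => (tangentSub (m := m) x).starProjection) =ᶠ[𝓝 x₀]
      rangeProj ∘ (fderiv ℝ ψ) ∘ extChartAt (𝓡 m) x₀ := by
    filter_upwards [extChartAt_source_mem_nhds (I := 𝓡 m) x₀] with x hx
    have hx' := (extChartAt (𝓡 m) x₀).map_source hx
    have h := hrange _ hx'
    rw [(extChartAt (𝓡 m) x₀).left_inv hx] at h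
    exact (rangeProj_eq_starProjection (hinj _ hx') _ h).symm
  refine ContMDiffAt.congr_of_eventuallyEq ?_ heq
  have h1 : ContDiffAt ℝ ∞ (fderiv ℝ ψ) (extChartAt (𝓡 m) x₀ x₀) :=
    (hψ _ (mem_extChartAt_target x₀)).fderiv_right (by simp)
  exact (contDiffAt_rangeProj (hinj _ (mem_extChartAt_target x₀))).contMDiffAt.comp x₀
    (h1.contMDiffAt.comp x₀ contMDiffAt_extChartAt)
end

/-! ### The Weingarten map and the Hessian of the squared distance. -/

section
variable {n m : ℕ} {I : Set (EuclideanSpace ℝ (Fin n))} [ChartedSpace (EuclideanSpace ℝ (Fin m)) I]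

/-- The derivative at `x` of the orthogonal projection onto the tangent space. -/
def projDeriv (x : I) : EuclideanSpace ℝ (Fin m) →L[ℝ]
    EuclideanSpace ℝ (Fin n) →L[ℝ] EuclideanSpace ℝ (Fin n) :=
  mfderiv (𝓡 m) 𝓘(ℝ, EuclideanSpace ℝ (Fin n) →L[ℝ] EuclideanSpace ℝ (Fin n))
    (fun x : I => (tangentSub (m := m) x).starProjection) x

lemma normalSub_starProjection (x : I) (v : EuclideanSpace ℝ (Fin n)) :
    (normalSub (m := m) x).starProjection v = v - (tangentSub (m := m) x).starProjection v := by
  rw [normalSub, Submodule.starProjection_orthogonal]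
  rfl

lemma hasMFDerivAt_val
    (hI : IsSmoothEmbedding (𝓡 m) (𝓡 n) ∞ (Subtype.val : I → EuclideanSpace ℝ (Fin n))) (x : I) :
    HasMFDerivAt (𝓡 m) (𝓡 n) (Subtype.val : I → EuclideanSpace ℝ (Fin n)) x
      (tangentIncl (m := m) x) :=
  (hI.contMDiff.mdifferentiableAt (by simp)).hasMFDerivAt

/-- The differential of the function is pairing with `x - a`; because the metric is inherited, its
tangential dual is the projection of `x - a`. -/
lemma tangentIncl_riemannianGradient
    (hI : IsSmoothEmbedding (𝓡 m) (𝓡 n) ∞ (Subtype.val : I → EuclideanSpace ℝ (Fin n)))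
    [RiemannianBundle (fun x : I => TangentSpace (𝓡 m) x)]
    (hmetric : ∀ (x : I) (v w : TangentSpace (𝓡 m) x),
      inner ℝ v w = inner ℝ (tangentIncl (m := m) x v) (tangentIncl (m := m) x w))
    (a : EuclideanSpace ℝ (Fin n)) (x : I) :
    tangentIncl (m := m) x (riemannianGradient (m := m)
      (fun x' : I => (1 / 2 : ℝ) * ‖(x' : EuclideanSpace ℝ (Fin n)) - a‖ ^ 2) x) =
      (tangentSub (m := m) x).starProjection ((x : EuclideanSpace ℝ (Fin n)) - a) := by
  refine (Submodule.eq_starProjection_of_mem_of_inner_eq_zero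
    (LinearMap.mem_range_self (tangentIncl (m := m) x).toLinearMap _) ?_).symm
  rintro _ ⟨w, rfl⟩
  have hg : HasFDerivAt (fun y : EuclideanSpace ℝ (Fin n) => (1 / 2 : ℝ) * ‖y - a‖ ^ 2)
      (innerSL ℝ ((x : EuclideanSpace ℝ (Fin n)) - a)) (x : EuclideanSpace ℝ (Fin n)) := by
    have := (((hasFDerivAt_id (x : EuclideanSpace ℝ (Fin n))).sub_const a).norm_sq).const_mul (1 / 2 : ℝ)
    convert! this using 1
    ext v
    simp
  have hd := (hg.hasMFDerivAt.comp x (hasMFDerivAt_val hI x)).mfderiv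
  have hgrad : inner ℝ (riemannianGradient (m := m)
      (fun x' : I => (1 / 2 : ℝ) * ‖(x' : EuclideanSpace ℝ (Fin n)) - a‖ ^ 2) x) w =
      inner ℝ ((x : EuclideanSpace ℝ (Fin n)) - a) (tangentIncl (m := m) x w) := by
    have : FiniteDimensional ℝ (TangentSpace (𝓡 m) x) :=
      inferInstanceAs (FiniteDimensional ℝ (EuclideanSpace ℝ (Fin m)))
    have : CompleteSpace (TangentSpace (𝓡 m) x) := FiniteDimensional.complete ℝ _
    refine (InnerProductSpace.toDual_symm_apply).trans ?_
    exact congrArg (fun L : EuclideanSpace ℝ (Fin m) →L[ℝ] ℝ => L w) hd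
  rw [inner_sub_left, sub_eq_zero]
  exact hgrad.symm.trans (hmetric x _ w)

variable [IsManifold (𝓡 m) ∞ I]

lemma hasMFDerivAt_starProjection_tangentSub
    (hI : IsSmoothEmbedding (𝓡 m) (𝓡 n) ∞ (Subtype.val : I → EuclideanSpace ℝ (Fin n))) (x : I) :
    HasMFDerivAt (𝓡 m) 𝓘(ℝ, EuclideanSpace ℝ (Fin n) →L[ℝ] EuclideanSpace ℝ (Fin n))
      (fun x : I => (tangentSub (m := m) x).starProjection) x (projDeriv (m := m) x) :=
  ((contMDiff_starProjection_tangentSub hI).mdifferentiableAt (by simp)).hasMFDerivAt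

/-- The normal field is `η - P η` with `η` constant, so minus its derivative is `(DP) η`. -/
lemma weingarten_apply
    (hI : IsSmoothEmbedding (𝓡 m) (𝓡 n) ∞ (Subtype.val : I → EuclideanSpace ℝ (Fin n)))
    (x : I) (η : EuclideanSpace ℝ (Fin n)) (w : EuclideanSpace ℝ (Fin m)) :
    weingarten (m := m) x η w = tangentProj (m := m) x (projDeriv (m := m) x w η) := by
  have h := (hasMFDerivAt_const (I := 𝓡 m) (I' := 𝓡 n) η x).sub
    ((hasMFDerivAt_starProjection_tangentSub hI x).clm_apply
      (hasMFDerivAt_const (I := 𝓡 m) (I' := 𝓡 n) η x))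
  have hf : (fun x' : I => (normalSub (m := m) x').starProjection η) =
      (fun _ => η) - fun x' : I => (tangentSub (m := m) x').starProjection η :=
    funext fun x' => normalSub_starProjection x' η
  have h' := (hf ▸ h).mfderiv
  rw [weingarten]
  refine congrArg (tangentProj (m := m) x) (Eq.trans (congrArg (fun L : EuclideanSpace ℝ (Fin m) →L[ℝ]
    EuclideanSpace ℝ (Fin n) => -(L w)) h') ?_)
  change -((0 : EuclideanSpace ℝ (Fin n)) - ((tangentSub (m := m) x).starProjection 0 +
    projDeriv (m := m) x w η)) = _
  simp

lemma curvatureOperator_apply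
    (hI : IsSmoothEmbedding (𝓡 m) (𝓡 n) ∞ (Subtype.val : I → EuclideanSpace ℝ (Fin n)))
    (x : I) (η : EuclideanSpace ℝ (Fin n)) (w : TangentSpace (𝓡 m) x) :
    curvatureOperator (m := m) x η w =
      w - tangentProj (m := m) x (projDeriv (m := m) x w η) := by
  exact congrArg (fun u : TangentSpace (𝓡 m) x => w - u) (weingarten_apply hI x η w)

/-- By the product rule the derivative of the gradient `P (x - a)` along `w` is `P w + (D_w P)(x -
a)`, whose tangential part is `w - S_η w`. -/
lemma riemannianHessian_eq
    (hI : IsSmoothEmbedding (𝓡 m) (𝓡 n) ∞ (Subtype.val : I → EuclideanSpace ℝ (Fin n)))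
    [RiemannianBundle (fun x : I => TangentSpace (𝓡 m) x)]
    (hmetric : ∀ (x : I) (v w : TangentSpace (𝓡 m) x),
      inner ℝ v w = inner ℝ (tangentIncl (m := m) x v) (tangentIncl (m := m) x w))
    (a : EuclideanSpace ℝ (Fin n)) (x : I) :
    riemannianHessian (m := m)
      (fun x' : I => (1 / 2 : ℝ) * ‖(x' : EuclideanSpace ℝ (Fin n)) - a‖ ^ 2) x =
      curvatureOperator x (a - x) := by
  have h := (hasMFDerivAt_starProjection_tangentSub hI x).clm_apply
    ((hasMFDerivAt_val hI x).sub (hasMFDerivAt_const (I := 𝓡 m) (I' := 𝓡 n) a x))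
  have hf : (fun x' : I => tangentIncl (m := m) x' (riemannianGradient (m := m)
      (fun x' : I => (1 / 2 : ℝ) * ‖(x' : EuclideanSpace ℝ (Fin n)) - a‖ ^ 2) x')) = fun x' : I =>
      (tangentSub (m := m) x').starProjection ((x' : EuclideanSpace ℝ (Fin n)) - a) :=
    funext (tangentIncl_riemannianGradient hI hmetric a)
  ext1 w
  refine Eq.trans ?_ (curvatureOperator_apply hI x (a - x) w).symm
  rw [riemannianHessian, hf]
  refine Eq.trans (congrArg (fun L : EuclideanSpace ℝ (Fin m) →L[ℝ] EuclideanSpace ℝ (Fin n) =>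
    tangentProj (m := m) x (L w)) h.mfderiv) ?_
  change tangentProj (m := m) x ((tangentSub (m := m) x).starProjection
    (tangentIncl (m := m) x w - 0) + projDeriv (m := m) x w (x - a)) = _
  rw [sub_zero, map_add, ← tangentIncl_tangentProj hI, tangentProj_tangentIncl hI,
    tangentProj_tangentIncl hI, ← neg_sub a, map_neg, map_neg, ← sub_eq_add_neg]
end

/-! ### The critical locus and its projection to the ambient space. -/

section
variable {n m : ℕ} {I : Set (EuclideanSpace ℝ (Fin n))} [ChartedSpace (EuclideanSpace ℝ (Fin m)) I]

lemma mem_criticalLocus_iff (a : EuclideanSpace ℝ (Fin n)) (x : I) : (a, x) ∈ criticalLocus m I ↔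
    (tangentSub (m := m) x).starProjection (a - (x : EuclideanSpace ℝ (Fin n))) = 0 := by
  rw [Submodule.starProjection_apply_eq_zero_iff]
  rfl

variable [IsManifold (𝓡 m) ∞ I]

lemma tangentProj_starProjection
    (hI : IsSmoothEmbedding (𝓡 m) (𝓡 n) ∞ (Subtype.val : I → EuclideanSpace ℝ (Fin n)))
    (x : I) (v : EuclideanSpace ℝ (Fin n)) :
    tangentProj (m := m) x ((tangentSub (m := m) x).starProjection v) =
      tangentProj (m := m) x v := by
  rw [← tangentIncl_tangentProj hI, tangentProj_tangentIncl hI]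

lemma tangentProj_starProjection_add_projDeriv
    (hI : IsSmoothEmbedding (𝓡 m) (𝓡 n) ∞ (Subtype.val : I → EuclideanSpace ℝ (Fin n)))
    (x : I) (η u : EuclideanSpace ℝ (Fin n)) (w : TangentSpace (𝓡 m) x) :
    tangentProj (m := m) x ((tangentSub (m := m) x).starProjection
      (u - tangentIncl (m := m) x w) + projDeriv (m := m) x w η) =
      tangentProj (m := m) x u - curvatureOperator (m := m) x η w := by
  rw [curvatureOperator_apply hI, map_add, tangentProj_starProjection hI, map_sub,
    tangentProj_tangentIncl hI]
  abel

section Derivative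
variable {E H : Type*} [NormedAddCommGroup E] [NormedSpace ℝ E] [TopologicalSpace H]
  {J : ModelWithCorners ℝ E H} {X : Type*} [TopologicalSpace X] [ChartedSpace H X]

/-- The tangential part of the derivative of `s ↦ P_{ξ s} (α s - ξ s)`, where `P` is the
orthogonal projection onto the tangent space, is given by the curvature operator. -/
lemma exists_hasMFDerivAt_starProjection_sub
    (hI : IsSmoothEmbedding (𝓡 m) (𝓡 n) ∞ (Subtype.val : I → EuclideanSpace ℝ (Fin n)))
    {α : X → EuclideanSpace ℝ (Fin n)} {ξ : X → I} {s : X}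
    {α' : E →L[ℝ] EuclideanSpace ℝ (Fin n)} {ξ' : E →L[ℝ] EuclideanSpace ℝ (Fin m)}
    (hα : HasMFDerivAt J (𝓡 n) α s α') (hξ : HasMFDerivAt J (𝓡 m) ξ s ξ') :
    ∃ L : E →L[ℝ] EuclideanSpace ℝ (Fin n),
      HasMFDerivAt J (𝓡 n) (fun s => (tangentSub (m := m) (ξ s)).starProjection (α s - ξ s)) s L ∧
      ∀ v, (tangentProj (m := m) (ξ s) (L v) : EuclideanSpace ℝ (Fin m)) =
        (tangentProj (m := m) (ξ s) (α' v) : EuclideanSpace ℝ (Fin m)) -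
          (curvatureOperator (m := m) (ξ s) (α s - ξ s) (ξ' v) : EuclideanSpace ℝ (Fin m)) := by
  have h := ((hasMFDerivAt_starProjection_tangentSub hI (ξ s)).comp s hξ).clm_apply
    (hα.sub ((hasMFDerivAt_val hI (ξ s)).comp s hξ))
  exact ⟨_, h, fun v => tangentProj_starProjection_add_projDeriv hI (ξ s) _ (α' v) (ξ' v)⟩

/-- The derivative of the critical equation along a family of solutions: `H_η ẋ = P ȧ`. -/
lemma curvatureOperator_hasMFDerivAt_of_mem_criticalLocus
    (hI : IsSmoothEmbedding (𝓡 m) (𝓡 n) ∞ (Subtype.val : I → EuclideanSpace ℝ (Fin n)))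
    {α : X → EuclideanSpace ℝ (Fin n)} {ξ : X → I} {s : X}
    {α' : E →L[ℝ] EuclideanSpace ℝ (Fin n)} {ξ' : E →L[ℝ] EuclideanSpace ℝ (Fin m)}
    (hα : HasMFDerivAt J (𝓡 n) α s α') (hξ : HasMFDerivAt J (𝓡 m) ξ s ξ')
    (h : ∀ᶠ s' in 𝓝 s, (α s', ξ s') ∈ criticalLocus m I) (v : E) :
    (curvatureOperator (m := m) (ξ s) (α s - ξ s) (ξ' v) : EuclideanSpace ℝ (Fin m)) =
      tangentProj (m := m) (ξ s) (α' v) := by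
  obtain ⟨L, hL, hL'⟩ := exists_hasMFDerivAt_starProjection_sub hI hα hξ
  have h0 : (fun s => (tangentSub (m := m) (ξ s)).starProjection (α s - ξ s)) =ᶠ[𝓝 s]
      fun _ => 0 := by
    filter_upwards [h] with s' hs'
    exact (mem_criticalLocus_iff (α s') (ξ s')).1 hs'
  have hz : L = 0 := hasMFDerivAt_unique hL
    ((hasMFDerivAt_const (I := J) (I' := 𝓡 n) (0 : EuclideanSpace ℝ (Fin n)) s).congr_of_eventuallyEq
      h0)
  have h2 : tangentProj (m := m) (ξ s) (L v) = 0 := by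
    rw [hz]
    exact map_zero (tangentProj (m := m) (ξ s))
  have h1 : (0 : EuclideanSpace ℝ (Fin m)) = _ := h2.symm.trans (hL' v)
  exact (sub_eq_zero.1 h1.symm).symm

end Derivative
end

section
variable {n m : ℕ} {I : Set (EuclideanSpace ℝ (Fin n))} [ChartedSpace (EuclideanSpace ℝ (Fin m)) I]
  [IsManifold (𝓡 m) ∞ I]

/-- Once `‖P_x - P_{x₀}‖ < 1`, a vector `u` with `P_x u = u` and `P_{x₀} u = 0` satisfies `‖u‖ ≤
‖P_x - P_{x₀}‖ ‖u‖` and so vanishes. -/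
lemma eventually_starProjection_eq_zero_of_tangentProj_eq_zero
    (hI : IsSmoothEmbedding (𝓡 m) (𝓡 n) ∞ (Subtype.val : I → EuclideanSpace ℝ (Fin n)))
    (x₀ : I) : ∀ᶠ x in 𝓝 x₀, ∀ v : EuclideanSpace ℝ (Fin n),
      tangentProj (m := m) x₀ ((tangentSub (m := m) x).starProjection v) = 0 →
      (tangentSub (m := m) x).starProjection v = 0 := by
  have hc := (contMDiff_starProjection_tangentSub hI).continuous.tendsto x₀
  filter_upwards [hc.eventually (Metric.ball_mem_nhds _ one_pos)] with x hx v hv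
  rw [dist_eq_norm] at hx
  rw [tangentProj_eq_zero_iff hI] at hv
  have h0 := (Submodule.starProjection_apply_eq_zero_iff (tangentSub (m := m) x₀)).2 hv
  set u := (tangentSub (m := m) x).starProjection v with hu
  have hu' : (tangentSub (m := m) x).starProjection u = u :=
    Submodule.starProjection_eq_self_iff.2 (Submodule.starProjection_apply_mem _ v)
  have hle := ((tangentSub (m := m) x).starProjection -
    (tangentSub (m := m) x₀).starProjection).le_opNorm u
  rw [sub_apply, hu', h0, sub_zero] at hle
  by_contra hne
  have := norm_pos_iff.2 hne
  nlinarith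

/-- The equation `P_y (b - y) = 0` has values in `ℝⁿ`, too many components for the inverse function
theorem. Projecting it to the fixed `m`-dimensional tangent space at `x` gives a square system with
the same zeros near `x`. -/
lemma exists_isSmoothLocalInverseOn_criticalLocus
    (hI : IsSmoothEmbedding (𝓡 m) (𝓡 n) ∞ (Subtype.val : I → EuclideanSpace ℝ (Fin n)))
    {a : EuclideanSpace ℝ (Fin n)} {x : I} (h : (a, x) ∈ criticalLocus m I)
    (hH : (curvatureOperator (m := m) x (a - x)).IsInvertible) :
    ∃ φ, IsSmoothLocalInverseOn (𝓡 n) ((𝓡 n).prod (𝓡 m)) (criticalLocus m I) Prod.fst (a, x) φ := by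
  let T : EuclideanSpace ℝ (Fin n) →L[ℝ] EuclideanSpace ℝ (Fin m) := tangentProj (m := m) x
  let g : EuclideanSpace ℝ (Fin n) × I → EuclideanSpace ℝ (Fin n) := fun w =>
    (tangentSub (m := m) w.2).starProjection (w.1 - w.2)
  let f : EuclideanSpace ℝ (Fin n) × I → EuclideanSpace ℝ (Fin n) × EuclideanSpace ℝ (Fin m) :=
    fun w => (w.1, T (g w))
  have hg : ContMDiff ((𝓡 n).prod (𝓡 m)) (𝓡 n) ∞ g :=
    ((contMDiff_starProjection_tangentSub hI).comp contMDiff_snd).clm_apply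
      (contMDiff_fst.sub (hI.contMDiff.comp contMDiff_snd))
  have hf : ContMDiff ((𝓡 n).prod (𝓡 m)) ((𝓡 n).prod (𝓡 m)) ∞ f :=
    contMDiff_fst.prodMk (T.contMDiff.comp hg)
  have hmem : ∀ w ∈ criticalLocus m I, f w = (w.1, 0) := by
    rintro ⟨b, y⟩ hw
    refine Prod.ext rfl ?_
    change T ((tangentSub (m := m) y).starProjection (b - y)) = 0
    rw [(mem_criticalLocus_iff b y).1 hw, map_zero]
  -- The derivative is `(u, w) ↦ (u, T u - H w)`, which is triangular.
  have hinv : (mfderiv ((𝓡 n).prod (𝓡 m)) ((𝓡 n).prod (𝓡 m)) f (a, x)).IsInvertible := by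
    let H : EuclideanSpace ℝ (Fin m) →L[ℝ] EuclideanSpace ℝ (Fin m) := curvatureOperator x (a - x)
    obtain ⟨L, hL, hL'⟩ := exists_hasMFDerivAt_starProjection_sub hI
      (hasMFDerivAt_fst (I := 𝓡 n) (I' := 𝓡 m) (a, x)) (hasMFDerivAt_snd (a, x))
    have hd : HasMFDerivAt ((𝓡 n).prod (𝓡 m)) ((𝓡 n).prod (𝓡 m)) f (a, x)
      ((ContinuousLinearMap.fst ℝ _ _).prod (T.comp L)) :=
      (hasMFDerivAt_fst (a, x)).prodMk (T.hasMFDerivAt.comp (a, x) hL)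
    rw [hd.mfderiv]
    let D : EuclideanSpace ℝ (Fin n) × EuclideanSpace ℝ (Fin m) →L[ℝ]
      EuclideanSpace ℝ (Fin n) × EuclideanSpace ℝ (Fin m) :=
      (ContinuousLinearMap.fst ℝ _ _).prod (T.comp L)
    refine isInvertible_of_injective (L := D) rfl ((injective_iff_map_eq_zero D).2 ?_)
    rintro ⟨u, w⟩ h0
    have hu : u = 0 := congrArg Prod.fst h0
    subst hu
    have hw : H w = 0 := by
      have h1 := (hL' (0, w)).symm.trans (congrArg Prod.snd h0)
      have h2 : T 0 - H w = 0 := h1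
      rw [map_zero, zero_sub, neg_eq_zero] at h2
      exact h2
    exact Prod.ext rfl (hH.injective (hw.trans (map_zero _).symm))
  obtain ⟨σ, hσ⟩ := exists_isSmoothLocalInverseOn_univ (.of_forall fun w => hf w) hinv
  have hfa : f (a, x) = (a, 0) := hmem _ h
  have hi : ContMDiff (𝓡 n) ((𝓡 n).prod (𝓡 m)) ∞ (fun b : EuclideanSpace ℝ (Fin n) =>
    (b, (0 : EuclideanSpace ℝ (Fin m)))) := contMDiff_id.prodMk contMDiff_const
  have hit : Tendsto (fun b : EuclideanSpace ℝ (Fin n) => (b, (0 : EuclideanSpace ℝ (Fin m))))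
      (𝓝 a) (𝓝 (f (a, x))) := by
    rw [hfa]
    exact hi.continuous.tendsto a
  refine ⟨fun b => σ (b, 0), ?_, ?_, ?_, ?_⟩
  · filter_upwards [hit.eventually hσ.smooth] with b hb
    exact hb.comp b hi.contMDiffAt
  · change σ (a, 0) = (a, x)
    rw [← hfa, hσ.base]
  -- `σ (b, 0)` solves only the projected equation; nearness to `x` upgrades it to the full one.
  · filter_upwards [hit.eventually hσ.right_inv, hit.eventually (hσ.tendsto.eventually
      ((continuous_snd.tendsto (a, x)).eventually
        (eventually_starProjection_eq_zero_of_tangentProj_eq_zero hI x)))] with b h1 h2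
    have h3 := congrArg Prod.fst h1.2
    have h4 := h2 _ (congrArg Prod.snd h1.2)
    exact ⟨(mem_criticalLocus_iff _ _).2 h4, h3⟩
  · filter_upwards [nhdsWithin_le_nhds (nhdsWithin_univ (a, x) ▸ hσ.left_inv),
      self_mem_nhdsWithin] with w h1 h2
    rw [← hmem w h2, h1]

/-- A kernel vector `w` of `H_η` makes `(0, w)` tangent to the critical locus, and the projection to
`a` kills it. The tangency comes from the smooth map `ψ`, which takes `(ν, y)` to `y` plus the
normal part of `ν`. -/
lemma isInvertible_curvatureOperator_of_derivInvertibleOn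
    (hI : IsSmoothEmbedding (𝓡 m) (𝓡 n) ∞ (Subtype.val : I → EuclideanSpace ℝ (Fin n)))
    {a : EuclideanSpace ℝ (Fin n)} {x : I} (h : (a, x) ∈ criticalLocus m I)
    (hd : DerivInvertibleOn (𝓡 n) ((𝓡 n).prod (𝓡 m)) (criticalLocus m I) Prod.fst (a, x)) :
    (curvatureOperator (m := m) x (a - x)).IsInvertible := by
  let H : EuclideanSpace ℝ (Fin m) →L[ℝ] EuclideanSpace ℝ (Fin m) := curvatureOperator x (a - x)
  refine isInvertible_of_injective (L := H) rfl ((injective_iff_map_eq_zero H).2 fun w hw => ?_)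
  let ψ : EuclideanSpace ℝ (Fin n) × I → EuclideanSpace ℝ (Fin n) × I := fun z =>
    (z.2 + z.1 - (tangentSub (m := m) z.2).starProjection z.1, z.2)
  have hψ : ContMDiff ((𝓡 n).prod (𝓡 m)) ((𝓡 n).prod (𝓡 m)) ∞ ψ :=
    (((hI.contMDiff.comp contMDiff_snd).add contMDiff_fst).sub
      (((contMDiff_starProjection_tangentSub hI).comp contMDiff_snd).clm_apply
        contMDiff_fst)).prodMk contMDiff_snd
  have hψA : ∀ z, ψ z ∈ criticalLocus m I := by
    rintro ⟨ν, y⟩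
    refine (mem_criticalLocus_iff _ _).2 ?_
    rw [add_sub_assoc, add_sub_cancel_left, map_sub, sub_eq_zero, eq_comm]
    exact Submodule.starProjection_eq_self_iff.2 (Submodule.starProjection_apply_mem _ ν)
  have hψ0 : ψ (a - x, x) = (a, x) := by
    refine Prod.ext ?_ rfl
    change (x : EuclideanSpace ℝ (Fin n)) + (a - x) - _ = a
    rw [(mem_criticalLocus_iff a x).1 h]
    abel
  -- Chosen so that the first component of `Dψ (ν, w)`, namely `w + ν - P ν - (D_w P)(a - x)`,
  -- vanishes. This works because `P ν = -H_η w = 0`.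
  let ν : EuclideanSpace ℝ (Fin n) := projDeriv x w (a - x) - tangentIncl (m := m) x w
  have hD := (((hasMFDerivAt_val hI x).comp (a - (x : EuclideanSpace ℝ (Fin n)), x)
      (hasMFDerivAt_snd (I := 𝓡 n) (I' := 𝓡 m) _)).add (hasMFDerivAt_fst (I := 𝓡 n) (I' := 𝓡 m) _)).sub
    (((hasMFDerivAt_starProjection_tangentSub hI x).comp (a - (x : EuclideanSpace ℝ (Fin n)), x)
      (hasMFDerivAt_snd (I := 𝓡 n) (I' := 𝓡 m) _)).clm_apply
        (hasMFDerivAt_fst (I := 𝓡 n) (I' := 𝓡 m) _))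
  have hD' := (hD.prodMk (hasMFDerivAt_snd (I := 𝓡 n) (I' := 𝓡 m) _)).mfderiv
  have hν : (tangentSub (m := m) x).starProjection ν = 0 := by
    have hw' : tangentProj (m := m) x ν = 0 := by
      have h1 (w : TangentSpace (𝓡 m) x) : tangentProj (m := m) x
          (projDeriv x w (a - x) - tangentIncl (m := m) x w) = -curvatureOperator x (a - x) w := by
        rw [curvatureOperator_apply hI, map_sub, tangentProj_tangentIncl hI, neg_sub]
      exact (h1 w).trans (neg_eq_zero.2 hw)
    rw [← tangentIncl_tangentProj hI, hw', map_zero]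
  have hval : (mfderiv ((𝓡 n).prod (𝓡 m)) ((𝓡 n).prod (𝓡 m)) ψ (a - x, x) (ν, w) :
      EuclideanSpace ℝ (Fin n) × EuclideanSpace ℝ (Fin m)) = (0, w) := by
    refine (congrArg (fun L : EuclideanSpace ℝ (Fin n) × EuclideanSpace ℝ (Fin m) →L[ℝ]
      EuclideanSpace ℝ (Fin n) × EuclideanSpace ℝ (Fin m) => L (ν, w)) hD').trans (Prod.ext ?_ rfl)
    change tangentIncl (m := m) x w + ν - ((tangentSub (m := m) x).starProjection ν +
      projDeriv (m := m) x w (a - x)) = 0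
    rw [hν]
    simp only [ν]
    abel
  have hmem : ((0, w) : EuclideanSpace ℝ (Fin n) × EuclideanSpace ℝ (Fin m)) ∈
      curveTangentSpace ((𝓡 n).prod (𝓡 m)) (criticalLocus m I) (a, x) := by
    have h1 := mfderiv_mem_curveTangentSpace (x := (a - (x : EuclideanSpace ℝ (Fin n)), x))
      (.of_forall fun z => hψ z) (.of_forall hψA) (ν, w)
    rw [hψ0] at h1
    exact hval ▸ h1
  have hz := hd.injective (a₁ := ⟨(0, w), hmem⟩) (a₂ := 0) (by
    refine Eq.trans ?_ (map_zero _).symm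
    exact congrArg (fun L : EuclideanSpace ℝ (Fin n) × EuclideanSpace ℝ (Fin m) →L[ℝ]
      EuclideanSpace ℝ (Fin n) => L (0, w)) mfderiv_fst)
  exact congrArg (fun v => (Subtype.val v).2) hz
end

/-! ### Intrinsic and ambient descriptions of an embedded submanifold. -/

section
variable {E H : Type*} [NormedAddCommGroup E] [NormedSpace ℝ E] [TopologicalSpace H]
  {J : ModelWithCorners ℝ E H} {X : Type*} [TopologicalSpace X] [ChartedSpace H X]
  {E' H' : Type*} [NormedAddCommGroup E'] [NormedSpace ℝ E'] [TopologicalSpace H']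
  {J' : ModelWithCorners ℝ E' H'} {M : Type*} [TopologicalSpace M] [ChartedSpace H' M]
  {E'' H'' : Type*} [NormedAddCommGroup E''] [NormedSpace ℝ E''] [TopologicalSpace H'']
  {J'' : ModelWithCorners ℝ E'' H''} {S : Set M} [ChartedSpace H'' S]
  {p : M → X}

/-- The intrinsic derivative is the ambient one after the injective derivative of the inclusion,
whose values lie in the curve tangent space. Injectivity suffices, as the dimensions agree. -/
lemma isInvertible_mfderiv_of_derivInvertibleOn [J''.Boundaryless] [IsManifold J'' ∞ S]
    [IsManifold J' ∞ M] [FiniteDimensional ℝ E] [FiniteDimensional ℝ E'']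
    (hfin : Module.finrank ℝ E'' = Module.finrank ℝ E)
    (hS : IsSmoothEmbedding J'' J' ∞ (Subtype.val : S → M)) {s : S}
    (hp : MDifferentiableAt J' J p s) (h : DerivInvertibleOn J J' S p s) :
    (mfderiv J'' J (fun s : S => p s) s).IsInvertible := by
  have hv : MDifferentiableAt J'' J' (Subtype.val : S → M) s :=
    hS.contMDiff.mdifferentiableAt (by simp)
  let D : E'' →L[ℝ] E := mfderiv J'' J (fun s : S => p s) s
  let V : E'' →L[ℝ] E' := mfderiv J'' J' (Subtype.val : S → M) s
  let P : E' →L[ℝ] E := mfderiv J' J p s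
  have hD : D = P.comp V := mfderiv_comp s hp hv
  have hmem (v : E'') : V v ∈ curveTangentSpace J' S (s : M) :=
    mfderiv_mem_curveTangentSpace (.of_forall fun s => hS.contMDiff.contMDiffAt)
      (.of_forall fun s => s.2) v
  refine isInvertible_of_injective (L := D) hfin fun v w hvw => ?_
  have hinj : Function.Injective V := IsImmersionAt.mfderiv_injective (hS.isImmersion.isImmersionAt s)
  rw [hD] at hvw
  exact hinj (congrArg Subtype.val (h.injective (a₁ := ⟨V v, hmem v⟩) (a₂ := ⟨V w, hmem w⟩) hvw))

lemma IsSmoothLocalInverseOn.val_comp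
    (hS : IsSmoothEmbedding J'' J' ∞ (Subtype.val : S → M)) {s : S} {σ : X → S}
    (hσ : IsSmoothLocalInverseOn J J'' univ (fun s : S => p s) s σ) :
    IsSmoothLocalInverseOn J J' S p s (fun x => (σ x : M)) where
  smooth := hσ.smooth.mono fun x hx => hS.contMDiff.contMDiffAt.comp x hx
  base := congrArg Subtype.val hσ.base
  right_inv := hσ.right_inv.mono fun x hx => ⟨(σ x).2, hx.2⟩
  left_inv := by
    rw [nhdsWithin_eq_map_subtype_coe s.2, eventually_map]
    have := hσ.left_inv
    rw [nhdsWithin_univ] at this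
    exact this.mono fun w hw => congrArg Subtype.val hw
end

/-! ### Norms and the tangential projection. -/

section
variable {n m k : ℕ} {I : Set (EuclideanSpace ℝ (Fin n))} [ChartedSpace (EuclideanSpace ℝ (Fin m)) I]
  [RiemannianBundle (fun x : I => TangentSpace (𝓡 m) x)]
  {O : Type*} [TopologicalSpace O] [ChartedSpace (EuclideanSpace ℝ (Fin k)) O]
  [RiemannianBundle (fun y : O => TangentSpace (𝓡 k) y)]

lemma enorm_tangentIncl
    (hmetric : ∀ (x : I) (v w : TangentSpace (𝓡 m) x),
      inner ℝ v w = inner ℝ (tangentIncl (m := m) x v) (tangentIncl (m := m) x w))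
    (x : I) (w : TangentSpace (𝓡 m) x) : ‖tangentIncl (m := m) x w‖ₑ = ‖w‖ₑ := by
  have h : ‖tangentIncl (m := m) x w‖ = ‖w‖ := by
    rw [@norm_eq_sqrt_real_inner _ _ _ w, hmetric, norm_eq_sqrt_real_inner]
  rw [← ofReal_norm, ← ofReal_norm, h]

variable [IsManifold (𝓡 m) ∞ I]

lemma enorm_tangentProj_le
    (hI : IsSmoothEmbedding (𝓡 m) (𝓡 n) ∞ (Subtype.val : I → EuclideanSpace ℝ (Fin n)))
    (hmetric : ∀ (x : I) (v w : TangentSpace (𝓡 m) x),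
      inner ℝ v w = inner ℝ (tangentIncl (m := m) x v) (tangentIncl (m := m) x w))
    (x : I) (v : EuclideanSpace ℝ (Fin n)) : ‖tangentProj (m := m) x v‖ₑ ≤ ‖v‖ₑ := by
  rw [← enorm_tangentIncl hmetric, tangentIncl_tangentProj hI, ← ofReal_norm, ← ofReal_norm]
  exact ENNReal.ofReal_le_ofReal (Submodule.norm_starProjection_apply_le _ _)

/-- The projection is a contraction, and tangent vectors, included isometrically, already attain all
the quotients. -/
lemma operatorSpectralNorm_comp_tangentProj
    (hI : IsSmoothEmbedding (𝓡 m) (𝓡 n) ∞ (Subtype.val : I → EuclideanSpace ℝ (Fin n)))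
    (hmetric : ∀ (x : I) (v w : TangentSpace (𝓡 m) x),
      inner ℝ v w = inner ℝ (tangentIncl (m := m) x v) (tangentIncl (m := m) x w))
    (a : EuclideanSpace ℝ (Fin n)) (x : I) (y : O)
    (L : TangentSpace (𝓡 m) x →L[ℝ] TangentSpace (𝓡 k) y)
    (L' : TangentSpace (𝓡 n) a →L[ℝ] TangentSpace (𝓡 k) y)
    (hL' : ∀ v : EuclideanSpace ℝ (Fin n), L' v = L (tangentProj (m := m) x v)) :
    operatorSpectralNorm (𝓡 n) (𝓡 k) L' = operatorSpectralNorm (𝓡 m) (𝓡 k) L := by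
  apply le_antisymm
  · refine iSup₂_le fun v hv => ?_
    have hle : ‖tangentProj (m := m) x v‖ₑ ≤ ‖v‖ₑ :=
      (enorm_tangentProj_le hI hmetric x v).trans_eq (enorm_tangentSpace_vectorSpace (x := a)).symm
    rw [hL' v]
    by_cases h0 : tangentProj (m := m) x v = 0
    · rw [h0, map_zero, enorm_zero, ENNReal.zero_div]
      exact zero_le
    · exact (ENNReal.div_le_div_left hle _).trans
        (le_iSup₂_of_le (f := fun (w : TangentSpace (𝓡 m) x) (_ : w ≠ 0) => ‖L w‖ₑ / ‖w‖ₑ) _ h0 le_rfl)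
  · refine iSup₂_le fun w hw => ?_
    have h1 : L' (tangentIncl (m := m) x w) = L w := by
      rw [hL', tangentProj_tangentIncl hI]
    have h0 : tangentIncl (m := m) x w ≠ 0 := fun h =>
      hw (tangentIncl_injective hI x (h.trans (map_zero _).symm))
    refine le_iSup₂_of_le (f := fun (v : TangentSpace (𝓡 n) a) (_ : v ≠ 0) => ‖L' v‖ₑ / ‖v‖ₑ)
      (tangentIncl (m := m) x w) h0 ?_
    have h2 := (enorm_tangentSpace_vectorSpace (x := a) (v := tangentIncl (m := m) x w)).trans
      (enorm_tangentIncl hmetric x w)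
    exact (congrArg₂ (· / ·) (congrArg enorm h1) h2).ge
end

/-! ### Well-posedness and the composed local solution map. -/

section
variable {n m k : ℕ} {I : Set (EuclideanSpace ℝ (Fin n))} [ChartedSpace (EuclideanSpace ℝ (Fin m)) I]
  {O : Type*} [TopologicalSpace O] [ChartedSpace (EuclideanSpace ℝ (Fin k)) O]
  {S : Set (I × O)}

lemma contMDiff_input [ChartedSpace (EuclideanSpace ℝ (Fin m)) S]
    (hS : IsSmoothEmbedding (𝓡 m) ((𝓡 m).prod (𝓡 k)) ∞ (Subtype.val : S → I × O)) :
    ContMDiff (𝓡 m) (𝓡 m) ∞ (fun s : S => s.1.1) := contMDiff_fst.comp hS.contMDiff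

section
variable [IsManifold (𝓡 m) ∞ I] [ChartedSpace (EuclideanSpace ℝ (Fin m)) S] [IsManifold (𝓡 m) ∞ S]

lemma exists_isSmoothLocalInverseOn_input
    (hS : IsSmoothEmbedding (𝓡 m) ((𝓡 m).prod (𝓡 k)) ∞ (Subtype.val : S → I × O)) {s : S}
    (h : (derivInput m S s).IsInvertible) :
    ∃ σ, IsSmoothLocalInverseOn (𝓡 m) (𝓡 m) univ (fun s : S => s.1.1) s σ :=
  exists_isSmoothLocalInverseOn_univ (.of_forall fun s => (contMDiff_input hS) s) h

lemma isInvertible_derivInput_of_derivInvertibleOn [IsManifold (𝓡 k) ∞ O]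
    (hS : IsSmoothEmbedding (𝓡 m) ((𝓡 m).prod (𝓡 k)) ∞ (Subtype.val : S → I × O)) {s : S}
    (h : DerivInvertibleOn (𝓡 m) ((𝓡 m).prod (𝓡 k)) S Prod.fst (s : I × O)) :
    (derivInput m S s).IsInvertible :=
  isInvertible_mfderiv_of_derivInvertibleOn rfl hS mdifferentiableAt_fst h

end

variable [RiemannianBundle (fun x : I => TangentSpace (𝓡 m) x)]
  [RiemannianBundle (fun y : O => TangentSpace (𝓡 k) y)]

lemma derivInvertibleOn_of_mem_wellPosed {z : I × O} (h : z ∈ wellPosed m k S) :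
    DerivInvertibleOn (𝓡 m) ((𝓡 m).prod (𝓡 k)) S Prod.fst z := by
  by_contra hn
  have := h.2
  rw [conditionNumber, if_neg hn] at this
  exact lt_irrefl _ this

variable [IsManifold (𝓡 m) ∞ I] [IsContMDiffRiemannianBundle (𝓡 m) ∞ (EuclideanSpace ℝ (Fin m))
    (fun x : I => TangentSpace (𝓡 m) x)]
  [T2Space O] [IsManifold (𝓡 k) ∞ O]
  [IsContMDiffRiemannianBundle (𝓡 k) ∞ (EuclideanSpace ℝ (Fin k))
    (fun y : O => TangentSpace (𝓡 k) y)]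

variable (k) in
lemma IsSmoothLocalInverseOn.mem_wellPosed {z : I × O} {φ : I → I × O}
    (h : IsSmoothLocalInverseOn (𝓡 m) ((𝓡 m).prod (𝓡 k)) S Prod.fst z φ) (hz : z ∈ S) :
    z ∈ wellPosed m k S := by
  have := isContinuousRiemannianBundle_of_contMDiff (F := EuclideanSpace ℝ (Fin m)) (𝓡 m) ∞
    (fun x : I => TangentSpace (𝓡 m) x)
  have := isContinuousRiemannianBundle_of_contMDiff (F := EuclideanSpace ℝ (Fin k)) (𝓡 k) ∞
    (fun y : O => TangentSpace (𝓡 k) y)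
  -- Together with the Hausdorff property this supplies the regularity of `O` that the formula for
  -- Rice's condition number needs.
  have : LocallyCompactSpace O := Manifold.locallyCompact_of_finiteDimensional (𝓡 k)
  refine ⟨hz, ?_⟩
  rw [h.conditionNumber_eq mdifferentiableAt_fst contMDiffAt_snd]
  exact operatorSpectralNorm_lt_top _

/-- The local solution map of the generalized critical point problem, composed of the ones of the
critical point problem and of the problem `S`. -/
lemma IsSmoothLocalInverseOn.gcpp {a : EuclideanSpace ℝ (Fin n)} {z : I × O}
    {φ : EuclideanSpace ℝ (Fin n) → EuclideanSpace ℝ (Fin n) × I} {τ : I → I × O}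
    (hφ : IsSmoothLocalInverseOn (𝓡 n) ((𝓡 n).prod (𝓡 m)) (criticalLocus m I) Prod.fst (a, z.1) φ)
    (hτ : IsSmoothLocalInverseOn (𝓡 m) ((𝓡 m).prod (𝓡 k)) S Prod.fst z τ) :
    IsSmoothLocalInverseOn (𝓡 n) ((𝓡 n).prod ((𝓡 m).prod (𝓡 k))) (gcppWellPosed m k S) Prod.fst
      (a, z) (fun b => (b, τ (φ b).2)) := by
  have hξ : Tendsto (fun b => (φ b).2) (𝓝 a) (𝓝 z.1) :=
    (continuous_snd.tendsto (a, z.1)).comp hφ.tendsto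
  refine ⟨?_, ?_, ?_, ?_⟩
  · change ∀ᶠ b in 𝓝 a, _
    filter_upwards [hφ.smooth, hξ.eventually hτ.smooth] with b h1 h2
    exact contMDiffAt_id.prodMk (h2.comp b (contMDiffAt_snd.comp b h1))
  · have h1 : φ a = (a, z.1) := hφ.base
    have h2 : τ z.1 = z := hτ.base
    change (a, τ (φ a).2) = (a, z)
    rw [h1, h2]
  · change ∀ᶠ b in 𝓝 a, _
    -- The values must be well-posed and not merely solutions, so both local inverses are used at
    -- the nearby points as well.
    filter_upwards [hφ.right_inv, hφ.eventually, hξ.eventually hτ.eventually,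
      hξ.eventually hτ.right_inv] with b h1 h2 h3 h4
    have h5 : φ b = (b, (τ (φ b).2).1) := Prod.ext h1.2 h4.2.symm
    refine ⟨⟨?_, h3.mem_wellPosed k h4.1⟩, rfl⟩
    change (b, (τ (φ b).2).1) ∈ criticalWellPosed m I
    rw [← h5]
    exact ⟨h1.1, h2.derivInvertibleOn mdifferentiableAt_fst⟩
  · have h1 : Tendsto (fun w : EuclideanSpace ℝ (Fin n) × (I × O) => (w.1, w.2.1))
        (𝓝[gcppWellPosed m k S] (a, z)) (𝓝[criticalLocus m I] (a, z.1)) :=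
      tendsto_nhdsWithin_iff.2 ⟨(Continuous.tendsto (by fun_prop) (a, z)).mono_left nhdsWithin_le_nhds,
        eventually_mem_nhdsWithin.mono fun w hw => hw.1.1⟩
    have h2 : Tendsto (fun w : EuclideanSpace ℝ (Fin n) × (I × O) => w.2)
        (𝓝[gcppWellPosed m k S] (a, z)) (𝓝[S] z) :=
      tendsto_nhdsWithin_iff.2 ⟨(Continuous.tendsto (by fun_prop) (a, z)).mono_left nhdsWithin_le_nhds,
        eventually_mem_nhdsWithin.mono fun w hw => hw.2.1⟩
    filter_upwards [h1.eventually hφ.left_inv, h2.eventually hτ.left_inv] with w h3 h4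
    refine Prod.ext rfl ?_
    have h5 : φ w.1 = (w.1, w.2.1) := h3
    have h6 : τ w.2.1 = w.2 := h4
    change τ (φ w.1).2 = w.2
    rw [h5, h6]

end

/-! ### The chain rule and the condition number formula. -/

section
variable {E H : Type*} [NormedAddCommGroup E] [NormedSpace ℝ E] [TopologicalSpace H]
  {J : ModelWithCorners ℝ E H} {X : Type*} [TopologicalSpace X] [ChartedSpace H X]
  {F G : Type*} [NormedAddCommGroup F] [NormedSpace ℝ F] [TopologicalSpace G]
  {K : ModelWithCorners ℝ F G} {Y : Type*} [TopologicalSpace Y] [ChartedSpace G Y]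
  {F' G' : Type*} [NormedAddCommGroup F'] [NormedSpace ℝ F'] [TopologicalSpace G']
  {K' : ModelWithCorners ℝ F' G'} {Z : Type*} [TopologicalSpace Z] [ChartedSpace G' Z]

/-- For composing derivatives at base points that agree only propositionally, such as `σ (φ a).2`
and `s`. -/
lemma HasMFDerivAt.comp_of_eq {f : X → Y} {g : Y → Z} {x : X} {y : Y} {f' : E →L[ℝ] F}
    {g' : F →L[ℝ] F'} (hg : HasMFDerivAt K K' g y g') (hf : HasMFDerivAt J K f x f')
    (hy : f x = y) : HasMFDerivAt J K' (g ∘ f) x (g'.comp f') := by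
  subst hy
  exact HasMFDerivAt.comp x hg hf

lemma HasMFDerivAt.operatorSpectralNorm_mfderiv [RiemannianBundle (fun x : X => TangentSpace J x)]
    [RiemannianBundle (fun y : Y => TangentSpace K y)] {f : X → Y} {x : X} {y : Y} {f' : E →L[ℝ] F}
    (hf : HasMFDerivAt J K f x f') (hy : f x = y) :
    operatorSpectralNorm J K (mfderiv J K f x) = operatorSpectralNorm J K (x := x) (y := y) f' := by
  subst hy
  rw [hf.mfderiv]

end

section
variable {n m k : ℕ} {I : Set (EuclideanSpace ℝ (Fin n))} [ChartedSpace (EuclideanSpace ℝ (Fin m)) I]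
  {O : Type*} [TopologicalSpace O] [ChartedSpace (EuclideanSpace ℝ (Fin k)) O]
  {S : Set (I × O)} [ChartedSpace (EuclideanSpace ℝ (Fin m)) S]

lemma hasMFDerivAt_localInverse_input
    (hS : IsSmoothEmbedding (𝓡 m) ((𝓡 m).prod (𝓡 k)) ∞ (Subtype.val : S → I × O)) {s : S} {σ : I → S}
    (hσ : IsSmoothLocalInverseOn (𝓡 m) (𝓡 m) univ (fun s : S => s.1.1) s σ)
    (h : (derivInput m S s).IsInvertible) :
    HasMFDerivAt (𝓡 m) (𝓡 m) σ s.1.1 (derivInput m S s).inverse := by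
  have hd := (hσ.contMDiffAt.mdifferentiableAt (by simp)).hasMFDerivAt
  have he (v : TangentSpace (𝓡 m) s.1.1) : (derivInput m S s).inverse v =
      mfderiv (𝓡 m) (𝓡 m) σ s.1.1 v := by
    apply h.injective
    rw [h.self_apply_inverse]
    exact (hσ.mfderiv_comp_mfderiv ((contMDiff_input hS).mdifferentiableAt (by simp)) v).symm
  have he' : (mfderiv (𝓡 m) (𝓡 m) σ s.1.1 : EuclideanSpace ℝ (Fin m) →L[ℝ] EuclideanSpace ℝ (Fin m)) =
    (derivInput m S s).inverse := ContinuousLinearMap.ext fun v => (he v).symm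
  exact he' ▸ hd

variable [IsManifold (𝓡 m) ∞ I]

lemma hasMFDerivAt_localInverse_criticalLocus
    (hI : IsSmoothEmbedding (𝓡 m) (𝓡 n) ∞ (Subtype.val : I → EuclideanSpace ℝ (Fin n)))
    {a : EuclideanSpace ℝ (Fin n)} {x : I}
    {φ : EuclideanSpace ℝ (Fin n) → EuclideanSpace ℝ (Fin n) × I}
    (hφ : IsSmoothLocalInverseOn (𝓡 n) ((𝓡 n).prod (𝓡 m)) (criticalLocus m I) Prod.fst (a, x) φ)
    (hH : (curvatureOperator (m := m) x (a - x)).IsInvertible) :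
    HasMFDerivAt (𝓡 n) (𝓡 m) (fun b => (φ b).2) a
      ((curvatureOperator (m := m) x (a - x)).inverse ∘L tangentProj (m := m) x :
        EuclideanSpace ℝ (Fin n) →L[ℝ] EuclideanSpace ℝ (Fin m)) := by
  have hξ : MDifferentiableAt (𝓡 n) (𝓡 m) (fun b => (φ b).2) a :=
    (contMDiffAt_snd.comp a hφ.contMDiffAt).mdifferentiableAt (by simp : (∞ : ℕ∞ω) ≠ 0)
  have h0 : (φ a).2 = x := congrArg Prod.snd hφ.base
  let D : EuclideanSpace ℝ (Fin n) →L[ℝ] EuclideanSpace ℝ (Fin m) :=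
    mfderiv (𝓡 n) (𝓡 m) (fun b => (φ b).2) a
  have hD : HasMFDerivAt (𝓡 n) (𝓡 m) (fun b => (φ b).2) a D := hξ.hasMFDerivAt
  have hmem : ∀ᶠ b in 𝓝 a, (b, (φ b).2) ∈ criticalLocus m I := by
    have := hφ.right_inv
    filter_upwards [this] with b hb
    have hb' : φ b = (b, (φ b).2) := Prod.ext hb.2 rfl
    rw [← hb']
    exact hb.1
  have key (v : EuclideanSpace ℝ (Fin n)) :
      (curvatureOperator (m := m) x (a - x) (D v) : EuclideanSpace ℝ (Fin m)) =
        tangentProj (m := m) x v := by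
    have := curvatureOperator_hasMFDerivAt_of_mem_criticalLocus hI (hasMFDerivAt_id a) hD hmem v
    rw [h0] at this
    exact this
  have he : D = ((curvatureOperator (m := m) x (a - x)).inverse ∘L tangentProj (m := m) x :
        EuclideanSpace ℝ (Fin n) →L[ℝ] EuclideanSpace ℝ (Fin m)) := by
    refine ContinuousLinearMap.ext fun v => hH.injective ((key v).trans ?_)
    exact (hH.self_apply_inverse (tangentProj (m := m) x v)).symm
  exact he ▸ hD

variable [IsManifold (𝓡 m) ∞ S]
  [RiemannianBundle (fun x : I => TangentSpace (𝓡 m) x)]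
  [IsContMDiffRiemannianBundle (𝓡 m) ∞ (EuclideanSpace ℝ (Fin m))
    (fun x : I => TangentSpace (𝓡 m) x)]
  [T2Space O] [IsManifold (𝓡 k) ∞ O]
  [RiemannianBundle (fun y : O => TangentSpace (𝓡 k) y)]
  [IsContMDiffRiemannianBundle (𝓡 k) ∞ (EuclideanSpace ℝ (Fin k))
    (fun y : O => TangentSpace (𝓡 k) y)]

/-- Well-posedness includes invertible derivatives on both loci, which pass to `Dπ_I` and `H_η`.
Conversely the inverse function theorem gives smooth local inverses, and these force the derivative
conditions and finiteness. -/
lemma mem_gcppWellPosed_iff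
    (hI : IsSmoothEmbedding (𝓡 m) (𝓡 n) ∞ (Subtype.val : I → EuclideanSpace ℝ (Fin n)))
    (hS : IsSmoothEmbedding (𝓡 m) ((𝓡 m).prod (𝓡 k)) ∞ (Subtype.val : S → I × O))
    {a : EuclideanSpace ℝ (Fin n)} {s : S} (h : (a, s.1.1) ∈ criticalLocus m I) :
    (a, (s : I × O)) ∈ gcppWellPosed m k S ↔ (derivInput m S s).IsInvertible ∧
      (curvatureOperator (m := m) s.1.1 (a - s.1.1)).IsInvertible := by
  constructor
  · intro hw
    exact ⟨isInvertible_derivInput_of_derivInvertibleOn hS (derivInvertibleOn_of_mem_wellPosed hw.2),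
      isInvertible_curvatureOperator_of_derivInvertibleOn hI h hw.1.2⟩
  · rintro ⟨hD, hH⟩
    obtain ⟨σ, hσ⟩ := exists_isSmoothLocalInverseOn_input hS hD
    obtain ⟨φ, hφ⟩ := exists_isSmoothLocalInverseOn_criticalLocus hI h hH
    exact ⟨⟨h, hφ.derivInvertibleOn mdifferentiableAt_fst⟩, (hσ.val_comp hS).mem_wellPosed k s.2⟩

theorem gcppConditionNumber_eq_gcppSpectralNorm
    (hI : IsSmoothEmbedding (𝓡 m) (𝓡 n) ∞ (Subtype.val : I → EuclideanSpace ℝ (Fin n)))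
    (hmetric : ∀ (x : I) (v w : TangentSpace (𝓡 m) x),
      inner ℝ v w = inner ℝ (tangentIncl (m := m) x v) (tangentIncl (m := m) x w))
    (hS : IsSmoothEmbedding (𝓡 m) ((𝓡 m).prod (𝓡 k)) ∞ (Subtype.val : S → I × O))
    {a : EuclideanSpace ℝ (Fin n)} {s : S} (h : (a, s.1.1) ∈ criticalLocus m I) :
    gcppConditionNumber m k S (a, (s : I × O)) = gcppSpectralNorm m k S s (a - s.1.1) := by
  by_cases hw : (derivInput m S s).IsInvertible ∧
      (curvatureOperator (m := m) s.1.1 (a - s.1.1)).IsInvertible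
  swap
  · rw [gcppConditionNumber, if_neg (fun h' => hw ((mem_gcppWellPosed_iff hI hS h).1 h')),
      gcppSpectralNorm, if_neg hw]
  rw [gcppConditionNumber, if_pos ((mem_gcppWellPosed_iff hI hS h).2 hw), gcppSpectralNorm, if_pos hw]
  obtain ⟨σ, hσ⟩ := exists_isSmoothLocalInverseOn_input hS hw.1
  obtain ⟨φ, hφ⟩ := exists_isSmoothLocalInverseOn_criticalLocus hI h hw.2
  have := isContinuousRiemannianBundle_of_contMDiff (F := EuclideanSpace ℝ (Fin k)) (𝓡 k) ∞
    (fun y : O => TangentSpace (𝓡 k) y)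
  have : LocallyCompactSpace O := Manifold.locallyCompact_of_finiteDimensional (𝓡 k)
  have hΦ := hφ.gcpp (hσ.val_comp hS)
  have hout : ContMDiff (𝓡 m) (𝓡 k) ∞ (fun s : S => s.1.2) := contMDiff_snd.comp hS.contMDiff
  have hO : HasMFDerivAt (𝓡 m) (𝓡 k) (fun s : S => s.1.2) s (derivOutput m k S s) :=
    (hout.mdifferentiableAt (by simp)).hasMFDerivAt
  have h1 : (φ a).2 = s.1.1 := congrArg Prod.snd hφ.base
  have h2 : σ (φ a).2 = s := by rw [h1]; exact hσ.base
  -- The chain rule: the solution map has derivative `Dπ_O (Dπ_I)⁻¹ H_η⁻¹ P_x`.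
  have hd := hO.comp_of_eq ((hasMFDerivAt_localInverse_input hS hσ hw.1).comp_of_eq
    (hasMFDerivAt_localInverse_criticalLocus hI hφ hw.2) h1) h2
  refine (hΦ.conditionNumber_eq mdifferentiableAt_fst
    (contMDiffAt_snd.comp _ contMDiffAt_snd)).trans ?_
  refine (hd.operatorSpectralNorm_mfderiv (congrArg (fun s : S => s.1.2) h2)).trans ?_
  exact operatorSpectralNorm_comp_tangentProj hI hmetric a s.1.1 s.1.2 _ _ fun v => rfl
end

end

theorem mainTheorem1 {n m k : ℕ}
    -- the input manifold, an embedded submanifold of `ℝⁿ` with the inherited metric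
    (I : Set (EuclideanSpace ℝ (Fin n)))
    [ChartedSpace (EuclideanSpace ℝ (Fin m)) I] [IsManifold (𝓡 m) ∞ I]
    (hI : IsSmoothEmbedding (𝓡 m) (𝓡 n) ∞ (Subtype.val : I → EuclideanSpace ℝ (Fin n)))
    [RiemannianBundle (fun x : I => TangentSpace (𝓡 m) x)]
    [IsContMDiffRiemannianBundle (𝓡 m) ∞ (EuclideanSpace ℝ (Fin m))
      (fun x : I => TangentSpace (𝓡 m) x)]
    (hmetric : ∀ (x : I) (v w : TangentSpace (𝓡 m) x),
      inner ℝ v w = inner ℝ (tangentIncl (m := m) x v) (tangentIncl (m := m) x w))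
    -- the output manifold, a Riemannian manifold
    {O : Type*} [TopologicalSpace O] [T2Space O] [SecondCountableTopology O]
    [ChartedSpace (EuclideanSpace ℝ (Fin k)) O] [IsManifold (𝓡 k) ∞ O]
    [RiemannianBundle (fun y : O => TangentSpace (𝓡 k) y)]
    [IsContMDiffRiemannianBundle (𝓡 k) ∞ (EuclideanSpace ℝ (Fin k))
      (fun y : O => TangentSpace (𝓡 k) y)]
    -- the solution manifold, an embedded submanifold of `I × O` of the dimension of `I`
    (S : Set (I × O))
    [ChartedSpace (EuclideanSpace ℝ (Fin m)) S] [IsManifold (𝓡 m) ∞ S]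
    (hS : IsSmoothEmbedding (𝓡 m) ((𝓡 m).prod (𝓡 k)) ∞ (Subtype.val : S → I × O))
    (hsurj : Function.Surjective (fun s : S => s.1.1))
    (hopen : IsOpen {s : S | (s : I × O) ∈ wellPosed m k S})
    (hdense : Dense {s : S | (s : I × O) ∈ wellPosed m k S})
    -- a generalized critical point
    (a : EuclideanSpace ℝ (Fin n)) (x : I) (y : O) (h : (a, (x, y)) ∈ gcppLocus m S) :
    riemannianHessian (m := m) (fun x' : I => (1 / 2 : ℝ) * ‖(x' : EuclideanSpace ℝ (Fin n)) - a‖ ^ 2) x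
        = curvatureOperator x (a - x) ∧
    gcppConditionNumber m k S (a, (x, y)) = gcppSpectralNorm m k S ⟨(x, y), h.2⟩ (a - x) ∧
    ((a, (x, y)) ∉ gcppWellPosed m k S →
      ¬ (derivInput m S ⟨(x, y), h.2⟩).IsInvertible ∨
      ¬ (curvatureOperator (m := m) x (a - x)).IsInvertible) := by
  have hc : (a, x) ∈ criticalLocus m I := h.1
  let s : S := ⟨(x, y), h.2⟩
  have hw : (a, (x, y)) ∈ gcppWellPosed m k S ↔ (derivInput m S s).IsInvertible ∧
      (curvatureOperator (m := m) x (a - x)).IsInvertible :=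
    mem_gcppWellPosed_iff (a := a) (s := s) hI hS hc
  have heq : gcppConditionNumber m k S (a, (x, y)) = gcppSpectralNorm m k S s (a - x) :=
    gcppConditionNumber_eq_gcppSpectralNorm (a := a) (s := s) hI hmetric hS hc
  refine ⟨riemannianHessian_eq hI hmetric a x, heq, fun h' => ?_⟩
  rw [← not_and_or]
  exact fun hinv => h' (hw.2 hinv)
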